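/- Let $G=PSL(2,\mathbb C)=SL(2,\mathbb C)/\{\pm I\}$, a complex Lie group with Lie algebra $\mathfrak{sl}(2,\mathbb C)=T_IG$ and complex Killing form $Kill(u,v)=\operatorname{tr}(\mathrm{ad}\,u\circ \mathrm{ad}\,v)$. For $A\in G$ and $U,V\in T_AG$ put \[\langle U,V\rangle_A=\tfrac18\,Kill\big(d_A(L_{A^{-1}})U,\;d_A(L_{A^{-1}})V\big),\] where $L_{A^{-1}}$ is the left translation by $A^{-1}$, and let $SL(2,\mathbb C)$ carry the pull-back of $\langle\cdot,\cdot\rangle$ under the projection $SL(2,\mathbb C)\to PSL(2,\mathbb C)$. Write $\|V\|^2=\langle V,V\rangle$. These are holomorphic Riemannian metrics, i.e. symmetric, non-degenerate, complex bilinear on every tangent space, and such that $\langle X,Y\rangle$ is holomorphic for all local holomorphic vector fields $X,Y$. Each of them has a Levi-Civita connection, i.e. a connection $D$ on the tangent bundle of the underlying real manifold with $X\langle Y,Z\rangle=\langle D_XY,Z\rangle+\langle Y,D_XZ\rangle$ and $D_XY-D_YX=[X,Y]$ for all vector fields. Let $D$ be the Levi-Civita connection of $PSL(2,\mathbb C)$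 and $R$ its curvature tensor, $R(X,Y)Z=D_XD_YZ-D_YD_XZ-D_{[X,Y]}Z$. Then: 1. If $X,Y$ are left-invariant vector fields on $PSL(2,\mathbb C)$, then $D_XY=\frac12[X,Y]$. 2. For all $V_1,V_2,V_3\in\mathfrak{sl}(2,\mathbb C)=T_I\,PSL(2,\mathbb C)$, $R(V_1,V_2)V_3=-\frac14[[V_1,V_2],V_3]$. 3. For all $V_1,V_2\in\mathfrak{sl}(2,\mathbb C)$, $\|[V_1,V_2]\|^2=-4\|V_1\|^2\|V_2\|^2+4\langle V_1,V_2\rangle^2$. 4. $PSL(2,\mathbb C)$ and $SL(2,\mathbb C)$ have constant complex sectional curvature $-1$: for every point $p$ and every two-dimensional complex subspace $\mathrm{Span}_{\mathbb C}(V,W)$ of the tangent space at $p$ on which $\langle\cdot,\cdot\rangle$ is non-degenerate, \[\frac{\langle R(V,W)W,V\rangle}{\|V\|^2\|W\|^2-\langle V,W\rangle^2}=-1,\] where $R$ is the curvature tensor of the Levi-Civita connection of the respective metric. -/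

import Mathlib

open scoped Manifold ContDiff Bundle

noncomputable section

/-! ### Complex Lie groups from one chart at the identity -/

section TranslatedCharts

variable {E : Type*} [NormedAddCommGroup E]
  {G : Type*} [Group G] [TopologicalSpace G] [IsTopologicalGroup G]

/-- The chart `x ↦ e (g⁻¹ * x)` around `g`, where `e` is a chart around `1`. -/
def translatedChart (e : OpenPartialHomeomorph G E) (g : G) : OpenPartialHomeomorph G E :=
  (Homeomorph.mulLeft g⁻¹).transOpenPartialHomeomorph e

theorem translatedChart_apply (e : OpenPartialHomeomorph G E) (g x : G) :
    translatedChart e g x = e (g⁻¹ * x) := rfl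

theorem translatedChart_symm_apply (e : OpenPartialHomeomorph G E) (g : G) (x : E) :
    (translatedChart e g).symm x = g * e.symm x := by
  change (Homeomorph.mulLeft g⁻¹).symm (e.symm x) = _
  rw [Homeomorph.symm_apply_eq]
  simp

theorem mem_translatedChart_source (e : OpenPartialHomeomorph G E) (g x : G) :
    x ∈ (translatedChart e g).source ↔ g⁻¹ * x ∈ e.source := by
  simp [translatedChart]

theorem translatedChart_target (e : OpenPartialHomeomorph G E) (g : G) :
    (translatedChart e g).target = e.target := by
  simp [translatedChart]

/-- The atlas of all left translates of a chart around `1`. -/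
abbrev translatedChartedSpace (e : OpenPartialHomeomorph G E) (h1 : (1 : G) ∈ e.source) :
    ChartedSpace E G where
  atlas := Set.range (translatedChart e)
  chartAt := translatedChart e
  mem_chart_source g := by simpa [mem_translatedChart_source] using h1
  chart_mem_atlas g := ⟨g, rfl⟩

theorem isManifold_of_translatedChart [NormedSpace ℂ E] (e : OpenPartialHomeomorph G E) (h1 : (1 : G) ∈ e.source)
    (hT : ∀ g : G, ∀ x ∈ e.target, g * e.symm x ∈ e.source →
      ContDiffAt ℂ ω (fun y => e (g * e.symm y)) x) :
    letI := translatedChartedSpace e h1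
    IsManifold 𝓘(ℂ, E) ω G := by
  let := translatedChartedSpace e h1
  apply isManifold_of_contDiffOn
  rintro _ _ ⟨g, rfl⟩ ⟨h, rfl⟩
  intro x hx
  apply ContDiffAt.contDiffWithinAt
  have hx' : x ∈ e.target ∧ h⁻¹ * (g * e.symm x) ∈ e.source := by
    simpa [translatedChart_target, mem_translatedChart_source, translatedChart_symm_apply] using hx
  have := hT (h⁻¹ * g) x hx'.1 (by rw [mul_assoc]; exact hx'.2)
  refine this.congr_of_eventuallyEq (Filter.Eventually.of_forall fun y => ?_)
  simp [translatedChart_apply, translatedChart_symm_apply, mul_assoc]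

theorem lieGroup_of_translatedChart [NormedSpace ℂ E] (e : OpenPartialHomeomorph G E) (h1 : (1 : G) ∈ e.source)
    (hT : ∀ g : G, ∀ x ∈ e.target, g * e.symm x ∈ e.source →
      ContDiffAt ℂ ω (fun y => e (g * e.symm y)) x)
    (hM : ∀ g h : G, g * e.symm (e 1) * h * e.symm (e 1) ∈ e.source →
      ContDiffAt ℂ ω (fun p : E × E => e (g * e.symm p.1 * h * e.symm p.2)) (e 1, e 1))
    (hI : ∀ g h : G, g * (e.symm (e 1))⁻¹ * h ∈ e.source →
      ContDiffAt ℂ ω (fun y : E => e (g * (e.symm y)⁻¹ * h)) (e 1)) :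
    letI := translatedChartedSpace e h1
    LieGroup 𝓘(ℂ, E) ω G := by
  let := translatedChartedSpace e h1
  have := isManifold_of_translatedChart e h1 hT
  have h1' : e.symm (e 1) = 1 := e.left_inv h1
  have hc : ∀ g : G, chartAt E g = translatedChart e g := fun _ => rfl
  refine @LieGroup.mk _ _ _ _ _ _ _ _ _ _ _ _ _ ?_ ?_
  · refine @ContMDiffMul.mk _ _ _ _ _ _ _ _ _ _ _ _ _ _ ?_
    intro p
    rw [contMDiffAt_iff]
    refine ⟨continuous_mul.continuousAt, ContDiffAt.contDiffWithinAt ?_⟩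
    have := hM ((p.1 * p.2)⁻¹ * p.1) p.2 (by simp [h1', mul_assoc, h1])
    have key : (extChartAt (𝓘(ℂ, E).prod 𝓘(ℂ, E)) p) p = (e 1, e 1) := by
      rw [extChartAt_prod]
      simp [hc, translatedChart_apply, mfld_simps]
    rw [key]
    refine this.congr_of_eventuallyEq (Filter.Eventually.of_forall fun y => ?_)
    rw [extChartAt_prod]
    simp [hc, translatedChart_apply, translatedChart_symm_apply, mfld_simps, mul_assoc]
  · intro p
    rw [contMDiffAt_iff]
    refine ⟨continuous_inv.continuousAt, ContDiffAt.contDiffWithinAt ?_⟩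
    have := hI p p⁻¹ (by simp [h1', h1])
    have key : (extChartAt 𝓘(ℂ, E) p) p = e 1 := by
      simp [hc, translatedChart_apply, mfld_simps]
    rw [key]
    refine this.congr_of_eventuallyEq (Filter.Eventually.of_forall fun y => ?_)
    simp [hc, translatedChart_apply, translatedChart_symm_apply, mfld_simps, mul_assoc]

end TranslatedCharts

/-- A complex-analytic manifold is a real-analytic manifold for the same charts. -/
theorem isManifold_real_of_complex {E : Type*} [NormedAddCommGroup E] [NormedSpace ℂ E]
    {M : Type*} [TopologicalSpace M] [ChartedSpace E M] [IsManifold 𝓘(ℂ, E) ω M] :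
    IsManifold 𝓘(ℝ, E) ω M := by
  apply isManifold_of_contDiffOn
  intro e e' he he'
  have := contDiffGroupoid ω 𝓘(ℂ, E) |>.compatible he he'
  rw [contDiffGroupoid, mem_groupoid_of_pregroupoid] at this
  have h := this.1
  exact ContDiffOn.restrict_scalars ℝ h

/-! ### The complex Lie groups `SL(2,ℂ)` and `PSL(2,ℂ)` -/

/-- The space `𝔰𝔩(2,ℂ)` of trace-zero matrices, the model space for the charts below. -/
def TracelessMat : Type := LinearMap.ker (Matrix.traceLinearMap (Fin 2) ℂ ℂ)

namespace TracelessMat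

instance : AddCommGroup TracelessMat :=
  inferInstanceAs (AddCommGroup (LinearMap.ker (Matrix.traceLinearMap (Fin 2) ℂ ℂ)))

instance : Module ℂ TracelessMat :=
  inferInstanceAs (Module ℂ (LinearMap.ker (Matrix.traceLinearMap (Fin 2) ℂ ℂ)))

instance : Module.Finite ℂ TracelessMat :=
  inferInstanceAs (Module.Finite ℂ (LinearMap.ker (Matrix.traceLinearMap (Fin 2) ℂ ℂ)))

/-- The underlying matrix. -/
def toMat : TracelessMat →ₗ[ℂ] Matrix (Fin 2) (Fin 2) ℂ :=
  (LinearMap.ker (Matrix.traceLinearMap (Fin 2) ℂ ℂ)).subtype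

theorem toMat_injective : Function.Injective toMat := Subtype.val_injective

theorem trace_toMat (N : TracelessMat) : (toMat N).trace = 0 := N.2

/-- The entries of a trace-zero matrix, as a vector with the sup norm. -/
def entries : TracelessMat →ₗ[ℂ] (Fin 2 → Fin 2 → ℂ) where
  toFun N i j := toMat N i j
  map_add' _ _ := by ext; simp
  map_smul' _ _ := by ext; simp

instance : NormedAddCommGroup TracelessMat :=
  NormedAddCommGroup.induced TracelessMat (Fin 2 → Fin 2 → ℂ) entries
    (fun _ _ h => toMat_injective (by ext i j; exact congrFun (congrFun h i) j))

instance : NormedSpace ℂ TracelessMat :=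
  NormedSpace.induced ℂ TracelessMat (Fin 2 → Fin 2 → ℂ) entries

instance : CompleteSpace TracelessMat := FiniteDimensional.complete ℂ TracelessMat

/-- The trace-zero part `A - (tr A / 2) I` of a matrix. -/
def proj : Matrix (Fin 2) (Fin 2) ℂ →ₗ[ℂ] TracelessMat where
  toFun A := ⟨A - (A.trace / 2) • 1, by
    change Matrix.trace (A - (A.trace / 2) • (1 : Matrix (Fin 2) (Fin 2) ℂ)) = 0
    simp⟩
  map_add' A B := by
    apply toMat_injective
    change A + B - _ = (A - _) + (B - _)
    rw [Matrix.trace_add, add_div, add_smul]; abel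
  map_smul' c A := by
    apply toMat_injective
    change c • A - _ = c • (A - _)
    rw [Matrix.trace_smul, smul_sub, smul_smul, smul_eq_mul, mul_div_assoc]

theorem toMat_proj (A : Matrix (Fin 2) (Fin 2) ℂ) : toMat (proj A) = A - (A.trace / 2) • 1 := rfl

theorem proj_toMat_add (N : TracelessMat) (c : ℂ) : proj (toMat N + c • 1) = N := by
  apply toMat_injective
  rw [toMat_proj, Matrix.trace_add, trace_toMat]
  simp [Matrix.trace_smul]

theorem continuous_proj : Continuous proj := proj.continuous_of_finiteDimensional

theorem continuous_toMat : Continuous toMat := toMat.continuous_of_finiteDimensional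

theorem contDiff_toMat (i j : Fin 2) : ContDiff ℂ ω (fun N => toMat N i j) :=
  (LinearMap.toContinuousLinearMap
    ((LinearMap.proj j).comp ((LinearMap.proj i).comp entries) : TracelessMat →ₗ[ℂ] ℂ)).contDiff

theorem contDiffAt_proj {F : Type*} [NormedAddCommGroup F] [NormedSpace ℂ F]
    {P : F → Matrix (Fin 2) (Fin 2) ℂ} {z : F}
    (hP : ∀ i j, ContDiffAt ℂ ω (fun y => P y i j) z) :
    ContDiffAt ℂ ω (fun y => proj (P y)) z := by
  have : (fun y => proj (P y)) =
      fun y => ∑ i, ∑ j, P y i j • proj (Matrix.single i j 1) := by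
    ext y
    conv_lhs => rw [Matrix.matrix_eq_sum_single (P y)]
    simp only [map_sum]
    refine Finset.sum_congr rfl fun i _ => Finset.sum_congr rfl fun j _ => ?_
    rw [← map_smul, Matrix.smul_single, smul_eq_mul, mul_one]
  rw [this]
  exact ContDiffAt.sum fun i _ => ContDiffAt.sum fun j _ => (hP i j).smul contDiffAt_const

/-- The square root `s` with `det (N + s I) = 1`, for `N` near `0`. -/
def root (N : TracelessMat) : ℂ := Complex.sqrt (1 - (toMat N).det)

theorem root_sq (N : TracelessMat) : root N ^ 2 = 1 - (toMat N).det := by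
  simp only [root, Complex.sqrt]
  exact_mod_cast Complex.cpow_nat_inv_pow (1 - (toMat N).det) two_ne_zero

theorem det_toMat_add (N : TracelessMat) (c : ℂ) :
    (toMat N + c • 1).det = c ^ 2 + (toMat N).det := by
  have h := trace_toMat N
  rw [Matrix.trace_fin_two] at h
  simp [Matrix.det_fin_two]
  linear_combination c * h

theorem det_toMat_add_root (N : TracelessMat) : (toMat N + root N • 1).det = 1 := by
  rw [det_toMat_add, root_sq]; ring

theorem contDiffAt_root {N : TracelessMat} (hN : 1 - (toMat N).det ∈ Complex.slitPlane) :
    ContDiffAt ℂ ω root N := by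
  have h0 : ∀ z ∈ Complex.slitPlane, ContDiffAt ℂ ω Complex.sqrt z := by
    intro z hz
    have : AnalyticAt ℂ Complex.sqrt z := analyticAt_id.cpow analyticAt_const hz
    exact this.contDiffAt
  have h1 : ContDiff ℂ ω (fun N : TracelessMat => 1 - (toMat N).det) := by
    simp only [Matrix.det_fin_two]
    exact contDiff_const.sub (((contDiff_toMat 0 0).mul (contDiff_toMat 1 1)).sub
      ((contDiff_toMat 0 1).mul (contDiff_toMat 1 0)))
  exact (h0 _ hN).comp N h1.contDiffAt

end TracelessMat

open TracelessMat

/-- `SL(2,ℂ)`, with Mathlib's (subspace) topology. -/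
abbrev SL2C : Type := Matrix.SpecialLinearGroup (Fin 2) ℂ

/-- `PSL(2,ℂ)`, the quotient of `SL(2,ℂ)` by its centre `{±I}`, with the quotient topology. -/
abbrev PSL2C : Type := Matrix.ProjectiveSpecialLinearGroup (Fin 2) ℂ

/-- The quotient homomorphism `SL(2,ℂ) → PSL(2,ℂ)`. -/
def slToPSL : SL2C →* PSL2C := QuotientGroup.mk' _

namespace SL2C

theorem continuous_coe : Continuous (fun A : SL2C => (A : Matrix (Fin 2) (Fin 2) ℂ)) :=
  continuous_subtype_val

/-- The inverse chart `N ↦ N + s I`. -/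
def ofTraceless (N : TracelessMat) : SL2C := ⟨toMat N + root N • 1, det_toMat_add_root N⟩

theorem contDiffAt_ofTraceless {N : TracelessMat} (hN : 1 - (toMat N).det ∈ Complex.slitPlane)
    (i j : Fin 2) : ContDiffAt ℂ ω (fun N => (ofTraceless N : Matrix (Fin 2) (Fin 2) ℂ) i j) N := by
  have : (fun N => (ofTraceless N : Matrix (Fin 2) (Fin 2) ℂ) i j) =
      fun N => toMat N i j + root N * (1 : Matrix (Fin 2) (Fin 2) ℂ) i j := rfl
  rw [this]
  exact (contDiff_toMat i j).contDiffAt.add ((contDiffAt_root hN).mul contDiffAt_const)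

theorem det_proj (A : SL2C) :
    1 - (toMat (proj (A : Matrix (Fin 2) (Fin 2) ℂ))).det
      = ((A : Matrix (Fin 2) (Fin 2) ℂ).trace / 2) ^ 2 := by
  have h := det_toMat_add (proj (A : Matrix (Fin 2) (Fin 2) ℂ))
    ((A : Matrix (Fin 2) (Fin 2) ℂ).trace / 2)
  rw [toMat_proj, sub_add_cancel, Matrix.SpecialLinearGroup.det_coe, ← toMat_proj] at h
  linear_combination h

theorem sqrt_sq_of_re_pos {z : ℂ} (hz : 0 < z.re) : Complex.sqrt (z ^ 2) = z := by
  have h := (abs_lt.mp (Complex.abs_arg_lt_pi_div_two_iff.mpr (Or.inl hz)))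
  simp only [Complex.sqrt]
  exact_mod_cast Complex.pow_cpow_nat_inv two_ne_zero
    (by push_cast; linarith [h.1]) (by push_cast; linarith [h.2])

theorem sq_mem_slitPlane {z : ℂ} (hz : 0 < z.re) : z ^ 2 ∈ Complex.slitPlane := by
  rw [Complex.mem_slitPlane_iff]
  by_cases h : z.im = 0
  · left; simp [pow_two, h]; positivity
  · right
    have : (z ^ 2).im = 2 * (z.re * z.im) := by simp [pow_two]; ring
    rw [this]
    exact mul_ne_zero two_ne_zero (mul_ne_zero hz.ne' h)

theorem sqrt_re_pos {z : ℂ} (hz : z ∈ Complex.slitPlane) : 0 < (Complex.sqrt z).re := by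
  have h0 := Complex.slitPlane_ne_zero hz
  have h1 : (Complex.sqrt z) = Complex.exp (Complex.log z * 2⁻¹) := by
    simp [Complex.sqrt, Complex.cpow_def_of_ne_zero h0]
  rw [h1, Complex.exp_re]
  refine mul_pos (Real.exp_pos _) (Real.cos_pos_of_mem_Ioo ?_)
  have h2 := Complex.neg_pi_lt_arg z
  have h3 := lt_of_le_of_ne (Complex.arg_le_pi z) (Complex.slitPlane_arg_ne_pi hz)
  have : (Complex.log z * 2⁻¹).im = z.arg / 2 := by
    simp [Complex.log_im, Complex.mul_im, div_eq_mul_inv]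
  rw [this]
  constructor <;> linarith

/-- The chart `A ↦ A - (tr A / 2) I` of `SL(2,ℂ)` on the neighbourhood `Re (tr A) > 0` of `I`. -/
def chartOne : OpenPartialHomeomorph SL2C TracelessMat where
  toFun A := proj (A : Matrix (Fin 2) (Fin 2) ℂ)
  invFun := ofTraceless
  source := {A | 0 < (A : Matrix (Fin 2) (Fin 2) ℂ).trace.re}
  target := {N | 1 - (toMat N).det ∈ Complex.slitPlane}
  map_source' A hA := by
    have hA' : 0 < (A : Matrix (Fin 2) (Fin 2) ℂ).trace.re := hA
    change 1 - (toMat (proj (A : Matrix (Fin 2) (Fin 2) ℂ))).det ∈ Complex.slitPlane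
    rw [det_proj]
    exact sq_mem_slitPlane (by simpa using hA')
  map_target' N hN := by
    have h := sqrt_re_pos hN
    change 0 < (toMat N + root N • 1).trace.re
    rw [Matrix.trace_add, trace_toMat]
    simpa [Matrix.trace_smul, root] using h
  left_inv' A hA := by
    have hA' : 0 < (A : Matrix (Fin 2) (Fin 2) ℂ).trace.re := hA
    apply Subtype.ext
    change toMat (proj (A : Matrix (Fin 2) (Fin 2) ℂ)) + root _ • 1 = _
    rw [root, det_proj, sqrt_sq_of_re_pos (by simpa using hA'), toMat_proj, sub_add_cancel]
  right_inv' N _ := proj_toMat_add N _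
  open_source := by
    have h : Continuous fun A : SL2C => (A : Matrix (Fin 2) (Fin 2) ℂ).trace.re :=
      Complex.continuous_re.comp continuous_coe.matrix_trace
    exact isOpen_lt continuous_const h
  open_target := Complex.isOpen_slitPlane.preimage
    (continuous_const.sub continuous_toMat.matrix_det)
  continuousOn_toFun := (continuous_proj.comp continuous_coe).continuousOn
  continuousOn_invFun N hN := by
    apply ContinuousAt.continuousWithinAt
    have h : ContinuousAt (fun N => toMat N + root N • (1 : Matrix (Fin 2) (Fin 2) ℂ)) N :=
      continuous_toMat.continuousAt.add ((contDiffAt_root hN).continuousAt.smul continuousAt_const)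
    exact h.codRestrict _

theorem one_mem_chartOne_source : (1 : SL2C) ∈ chartOne.source := by
  change 0 < ((1 : SL2C) : Matrix (Fin 2) (Fin 2) ℂ).trace.re
  simp

theorem contDiffAt_mul {F : Type*} [NormedAddCommGroup F] [NormedSpace ℂ F]
    {P Q : F → SL2C} {z : F}
    (hP : ∀ i j, ContDiffAt ℂ ω (fun y => (P y : Matrix (Fin 2) (Fin 2) ℂ) i j) z)
    (hQ : ∀ i j, ContDiffAt ℂ ω (fun y => (Q y : Matrix (Fin 2) (Fin 2) ℂ) i j) z) (i j : Fin 2) :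
    ContDiffAt ℂ ω (fun y => ((P y * Q y : SL2C) : Matrix (Fin 2) (Fin 2) ℂ) i j) z := by
  simp only [Matrix.SpecialLinearGroup.coe_mul, Matrix.mul_apply]
  exact ContDiffAt.sum fun k _ => (hP i k).mul (hQ k j)

theorem contDiffAt_inv {F : Type*} [NormedAddCommGroup F] [NormedSpace ℂ F]
    {P : F → SL2C} {z : F}
    (hP : ∀ i j, ContDiffAt ℂ ω (fun y => (P y : Matrix (Fin 2) (Fin 2) ℂ) i j) z) (i j : Fin 2) :
    ContDiffAt ℂ ω (fun y => (((P y)⁻¹ : SL2C) : Matrix (Fin 2) (Fin 2) ℂ) i j) z := by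
  simp only [Matrix.SpecialLinearGroup.coe_inv, Matrix.adjugate_fin_two]
  fin_cases i <;> fin_cases j <;> simp
  · exact hP 1 1
  · exact (hP 0 1).neg
  · exact (hP 1 0).neg
  · exact hP 0 0

instance : ChartedSpace TracelessMat SL2C :=
  translatedChartedSpace chartOne one_mem_chartOne_source

theorem contDiffAt_chart {N : TracelessMat} (hN : N ∈ chartOne.target) (i j : Fin 2) :
    ContDiffAt ℂ ω (fun N => (chartOne.symm N : Matrix (Fin 2) (Fin 2) ℂ) i j) N :=
  contDiffAt_ofTraceless hN i j

instance : LieGroup 𝓘(ℂ, TracelessMat) ω SL2C := by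
  have h0 := chartOne.map_source one_mem_chartOne_source
  refine lieGroup_of_translatedChart chartOne one_mem_chartOne_source ?_ ?_ ?_
  · intro g N hN _
    exact contDiffAt_proj (contDiffAt_mul (P := fun _ => g) (fun _ _ => contDiffAt_const)
      (contDiffAt_chart hN))
  · intro g h _
    refine contDiffAt_proj (contDiffAt_mul (contDiffAt_mul (contDiffAt_mul (P := fun _ => g)
      (fun _ _ => contDiffAt_const) fun i j => ?_) (fun _ _ => contDiffAt_const)) fun i j => ?_)
    · exact (contDiffAt_chart h0 i j).comp (chartOne 1, chartOne 1) contDiffAt_fst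
    · exact (contDiffAt_chart h0 i j).comp (chartOne 1, chartOne 1) contDiffAt_snd
  · intro g h _
    exact contDiffAt_proj (contDiffAt_mul (contDiffAt_mul (P := fun _ => g)
      (fun _ _ => contDiffAt_const) (contDiffAt_inv (contDiffAt_chart h0)))
      (fun _ _ => contDiffAt_const))

end SL2C

namespace PSL2C

theorem slToPSL_eq_iff {A B : SL2C} : slToPSL A = slToPSL B ↔ B = A ∨ B = -A := by
  have h : slToPSL A = slToPSL B ↔ A⁻¹ * B ∈ Subgroup.center SL2C := QuotientGroup.eq
  have hneg : Matrix.scalar (Fin 2) (-1 : ℂ) = -1 := by rw [map_neg, map_one]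
  rw [h, Matrix.SpecialLinearGroup.mem_center_iff]
  constructor
  · rintro ⟨r, hr, hrA⟩
    have hB : B = A * (A⁻¹ * B) := by group
    have hr' : r = 1 ∨ r = -1 := by
      rw [← sq_eq_one_iff]; simpa using hr
    rcases hr' with rfl | rfl
    · left
      have : A⁻¹ * B = 1 := Subtype.ext (by rw [← hrA]; simp)
      rw [hB, this, mul_one]
    · right
      have : A⁻¹ * B = -1 := Subtype.ext (by rw [← hrA, hneg]; simp)
      rw [hB, this, mul_neg, mul_one]
  · rintro (rfl | rfl)
    · exact ⟨1, by simp, by simp⟩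
    · exact ⟨-1, by simp, by rw [hneg]; simp⟩

theorem continuous_slToPSL : Continuous slToPSL := QuotientGroup.continuous_mk

theorem isOpenMap_slToPSL : IsOpenMap slToPSL := QuotientGroup.isOpenMap_coe

theorem injOn_slToPSL : Set.InjOn slToPSL SL2C.chartOne.source := by
  intro A hA B hB h
  rcases slToPSL_eq_iff.mp h with h | h
  · exact h.symm
  · exfalso
    have hA' : 0 < (A : Matrix (Fin 2) (Fin 2) ℂ).trace.re := hA
    have hB' : 0 < (B : Matrix (Fin 2) (Fin 2) ℂ).trace.re := hB
    rw [h] at hB'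
    simp only [Matrix.SpecialLinearGroup.coe_neg, Matrix.trace_neg, Complex.neg_re] at hB'
    linarith

/-- The projection `SL(2,ℂ) → PSL(2,ℂ)`, restricted to `Re (tr A) > 0`, where it is injective. -/
def projOne : OpenPartialHomeomorph SL2C PSL2C :=
  OpenPartialHomeomorph.ofContinuousOpen (injOn_slToPSL.toPartialEquiv _ _)
    continuous_slToPSL.continuousOn isOpenMap_slToPSL SL2C.chartOne.open_source

/-- The chart `±A ↦ A - (tr A / 2) I` (with `Re (tr A) > 0`) of `PSL(2,ℂ)` around `1`. -/
def chartOne : OpenPartialHomeomorph PSL2C TracelessMat :=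
  projOne.symm.trans SL2C.chartOne

theorem projOne_source : projOne.source = SL2C.chartOne.source := rfl

theorem projOne_symm_apply {A : SL2C} (hA : A ∈ SL2C.chartOne.source) :
    projOne.symm (slToPSL A) = A := projOne.left_inv hA

theorem chartOne_source : chartOne.source = slToPSL '' SL2C.chartOne.source := by
  ext x
  rw [chartOne, OpenPartialHomeomorph.trans_source]
  constructor
  · rintro ⟨h1, -⟩
    exact h1
  · rintro ⟨A, hA, rfl⟩
    refine ⟨⟨A, hA, rfl⟩, ?_⟩
    change projOne.symm (slToPSL A) ∈ SL2C.chartOne.source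
    rwa [projOne_symm_apply hA]

theorem chartOne_apply {A : SL2C} (hA : A ∈ SL2C.chartOne.source) :
    chartOne (slToPSL A) = SL2C.chartOne A := by
  change SL2C.chartOne (projOne.symm (slToPSL A)) = _
  rw [projOne_symm_apply hA]

theorem chartOne_symm_apply (N : TracelessMat) :
    chartOne.symm N = slToPSL (SL2C.chartOne.symm N) := rfl

theorem chartOne_target : chartOne.target ⊆ SL2C.chartOne.target := by
  rw [chartOne, OpenPartialHomeomorph.trans_target]
  exact Set.inter_subset_left

theorem one_mem_chartOne_source : (1 : PSL2C) ∈ chartOne.source := by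
  rw [chartOne_source]
  exact ⟨1, SL2C.one_mem_chartOne_source, map_one _⟩

theorem contDiffAt_chartOne {F : Type*} [NormedAddCommGroup F] [NormedSpace ℂ F]
    {P : F → SL2C} {z : F}
    (hP : ∀ i j, ContDiffAt ℂ ω (fun y => (P y : Matrix (Fin 2) (Fin 2) ℂ) i j) z)
    (hz : slToPSL (P z) ∈ chartOne.source) :
    ContDiffAt ℂ ω (fun y => chartOne (slToPSL (P y))) z := by
  have aux : ∀ Q : F → SL2C,
      (∀ i j, ContDiffAt ℂ ω (fun y => (Q y : Matrix (Fin 2) (Fin 2) ℂ) i j) z) →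
      Q z ∈ SL2C.chartOne.source →
      ContDiffAt ℂ ω (fun y => chartOne (slToPSL (Q y))) z := by
    intro Q hQ hQz
    refine (contDiffAt_proj hQ).congr_of_eventuallyEq ?_
    have hc : ContinuousAt (fun y => (Q y : Matrix (Fin 2) (Fin 2) ℂ).trace.re) z := by
      simp only [Matrix.trace_fin_two]
      exact Complex.continuous_re.continuousAt.comp
        ((hQ 0 0).continuousAt.add (hQ 1 1).continuousAt)
    have hQz' : 0 < (Q z : Matrix (Fin 2) (Fin 2) ℂ).trace.re := hQz
    filter_upwards [hc.eventually (lt_mem_nhds hQz')] with y hy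
    exact chartOne_apply hy
  rw [chartOne_source] at hz
  obtain ⟨A, hA, hAz⟩ := hz
  rcases slToPSL_eq_iff.mp hAz with h | h
  · exact aux P hP (h ▸ hA)
  · have h' : ∀ y, slToPSL (P y) = slToPSL (-P y) := fun y => slToPSL_eq_iff.mpr (Or.inr rfl)
    simp only [h']
    refine aux (fun y => -P y) (fun i j => ?_) (by simpa [h] using hA)
    simpa using (hP i j).neg

instance : ChartedSpace TracelessMat PSL2C :=
  translatedChartedSpace chartOne one_mem_chartOne_source

theorem slToPSL_surjective : Function.Surjective slToPSL := QuotientGroup.mk'_surjective _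

instance : LieGroup 𝓘(ℂ, TracelessMat) ω PSL2C := by
  have h0 := chartOne_target (chartOne.map_source one_mem_chartOne_source)
  refine lieGroup_of_translatedChart chartOne one_mem_chartOne_source ?_ ?_ ?_
  · intro g N hN hs
    obtain ⟨g, rfl⟩ := slToPSL_surjective g
    simp only [chartOne_symm_apply, ← map_mul] at hs ⊢
    exact contDiffAt_chartOne (SL2C.contDiffAt_mul (P := fun _ => g)
      (fun _ _ => contDiffAt_const) (SL2C.contDiffAt_chart (chartOne_target hN))) hs
  · intro g h hs
    obtain ⟨g, rfl⟩ := slToPSL_surjective g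
    obtain ⟨h, rfl⟩ := slToPSL_surjective h
    simp only [chartOne_symm_apply, ← map_mul] at hs ⊢
    refine contDiffAt_chartOne (SL2C.contDiffAt_mul (SL2C.contDiffAt_mul
      (SL2C.contDiffAt_mul (P := fun _ => g) (fun _ _ => contDiffAt_const) fun i j => ?_)
      (fun _ _ => contDiffAt_const)) fun i j => ?_) hs
    · exact (SL2C.contDiffAt_chart h0 i j).comp (chartOne 1, chartOne 1) contDiffAt_fst
    · exact (SL2C.contDiffAt_chart h0 i j).comp (chartOne 1, chartOne 1) contDiffAt_snd
  · intro g h hs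
    obtain ⟨g, rfl⟩ := slToPSL_surjective g
    obtain ⟨h, rfl⟩ := slToPSL_surjective h
    simp only [chartOne_symm_apply, ← map_mul, ← map_inv] at hs ⊢
    exact contDiffAt_chartOne (SL2C.contDiffAt_mul (SL2C.contDiffAt_mul (P := fun _ => g)
      (fun _ _ => contDiffAt_const) (SL2C.contDiffAt_inv (SL2C.contDiffAt_chart h0)))
      (fun _ _ => contDiffAt_const)) hs

end PSL2C

instance : IsManifold 𝓘(ℂ, TracelessMat) ω SL2C := inferInstance

instance : IsManifold 𝓘(ℂ, TracelessMat) ω PSL2C := inferInstance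

instance : IsManifold 𝓘(ℝ, TracelessMat) ω SL2C := isManifold_real_of_complex

instance : IsManifold 𝓘(ℝ, TracelessMat) ω PSL2C := isManifold_real_of_complex

/-! ### Holomorphic Riemannian metrics, their Levi-Civita connection and curvature -/

section HolomorphicRiemannian

variable {E : Type*} [NormedAddCommGroup E] [NormedSpace ℂ E]
  {M : Type*} [TopologicalSpace M] [ChartedSpace E M]

/-- A field of complex bilinear forms on the tangent spaces of a complex manifold. -/
abbrev BilinField (E : Type*) [NormedAddCommGroup E] [NormedSpace ℂ E]
    (M : Type*) [TopologicalSpace M] [ChartedSpace E M] : Type _ :=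
  Π x : M, LinearMap.BilinForm ℂ (TangentSpace 𝓘(ℂ, E) x)

/-- A real (not necessarily holomorphic) vector field on a complex manifold. -/
abbrev RealField (E : Type*) [NormedAddCommGroup E] [NormedSpace ℂ E]
    (M : Type*) [TopologicalSpace M] [ChartedSpace E M] : Type _ :=
  Π x : M, TangentSpace 𝓘(ℝ, E) x

/-- The function `⟨X, Y⟩`. The real and the complex tangent space at a point are the same space. -/
def BilinField.pair (g : BilinField E M) (X Y : RealField E M) (x : M) : ℂ := g x (X x) (Y x)

/-- Holomorphic Riemannian metrics: symmetric, non-degenerate fields of complex bilinear forms for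
which `⟨X, Y⟩` is holomorphic for all local holomorphic vector fields `X`, `Y`. -/
structure IsHolomorphicRiemannianMetric [IsManifold 𝓘(ℂ, E) ω M] (g : BilinField E M) : Prop where
  symm : ∀ x v w, g x v w = g x w v
  nondegenerate : ∀ x, (g x).Nondegenerate
  holomorphic : ∀ U : Set M, IsOpen U → ∀ X Y : Π x : M, TangentSpace 𝓘(ℂ, E) x,
    MDifferentiableOn 𝓘(ℂ, E) 𝓘(ℂ, E).tangent
      (fun x => (⟨x, X x⟩ : TangentBundle 𝓘(ℂ, E) M)) U →
    MDifferentiableOn 𝓘(ℂ, E) 𝓘(ℂ, E).tangent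
      (fun x => (⟨x, Y x⟩ : TangentBundle 𝓘(ℂ, E) M)) U →
    MDifferentiableOn 𝓘(ℂ, E) 𝓘(ℂ, ℂ) (fun x => g x (X x) (Y x)) U

variable [IsManifold 𝓘(ℝ, E) ω M]

/-- A vector field is (real) differentiable at `x`. -/
def RealField.DiffAt (X : RealField E M) (x : M) : Prop :=
  MDifferentiableAt 𝓘(ℝ, E) 𝓘(ℝ, E).tangent (fun y => (⟨y, X y⟩ : TangentBundle 𝓘(ℝ, E) M)) x

/-- Connections on the tangent bundle of the underlying real manifold; `D Y x (X x)` is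
`(D_X Y)(x)`. -/
abbrev RealConnection (E : Type*) [NormedAddCommGroup E] [NormedSpace ℂ E]
    (M : Type*) [TopologicalSpace M] [ChartedSpace E M] [IsManifold 𝓘(ℝ, E) ω M] : Type _ :=
  CovariantDerivative 𝓘(ℝ, E) E (TangentSpace 𝓘(ℝ, E) : M → Type _)

/-- The vector field `D_X Y`. -/
def RealConnection.along (D : RealConnection E M) (X Y : RealField E M) : RealField E M :=
  fun x => D Y x (X x)

/-- `D` is the Levi-Civita connection of `g`: it is compatible with the metric,
`X⟨Y, Z⟩ = ⟨D_X Y, Z⟩ + ⟨Y, D_X Z⟩`, and torsion free, `D_X Y - D_Y X = [X, Y]`. -/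
structure IsLeviCivita (g : BilinField E M) (D : RealConnection E M) : Prop where
  metric : ∀ (X Y Z : RealField E M) (x : M), Y.DiffAt x → Z.DiffAt x →
    mfderiv 𝓘(ℝ, E) 𝓘(ℝ, ℂ) (g.pair Y Z) x (X x) =
      g.pair (D.along X Y) Z x + g.pair Y (D.along X Z) x
  torsionFree : ∀ (X Y : RealField E M) (x : M), X.DiffAt x → Y.DiffAt x →
    D.along X Y x - D.along Y X x = VectorField.mlieBracket 𝓘(ℝ, E) X Y x

/-- `R(X, Y) Z = D_X D_Y Z - D_Y D_X Z - D_[X,Y] Z` for vector fields. -/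
def curvatureField (D : RealConnection E M) (X Y Z : RealField E M) : RealField E M :=
  fun x => D.along X (D.along Y Z) x - D.along Y (D.along X Z) x
    - D.along (VectorField.mlieBracket 𝓘(ℝ, E) X Y) Z x

/-- The curvature tensor at `x`: the value at `x` of `R(X, Y) Z` for smooth extensions `X, Y, Z` of
the three tangent vectors to a neighbourhood of `x` (constant in the chart at `x`; by tensoriality
the choice of the extension does not matter). -/
def curvatureTensor (D : RealConnection E M) (x : M) (u v w : TangentSpace 𝓘(ℝ, E) x) :
    TangentSpace 𝓘(ℝ, E) x :=
  curvatureField D (FiberBundle.extend E u) (FiberBundle.extend E v) (FiberBundle.extend E w) x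

/-- `v`, `w` is a basis of a non-degenerate complex plane in the tangent space at `x`. -/
def SpansNondegeneratePlane (g : BilinField E M) (x : M) (v w : TangentSpace 𝓘(ℂ, E) x) : Prop :=
  LinearIndependent ℂ ![v, w] ∧ ((g x).restrict (Submodule.span ℂ {v, w})).Nondegenerate

/-- The complex sectional curvature `⟨R(v, w) w, v⟩ / (‖v‖² ‖w‖² - ⟨v, w⟩²)` of the plane spanned
by `v` and `w`, where `‖v‖² = ⟨v, v⟩`. -/
def sectionalCurvature (g : BilinField E M) (D : RealConnection E M) (x : M)
    (v w : TangentSpace 𝓘(ℂ, E) x) : ℂ :=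
  g x (curvatureTensor D x v w w) v / (g x v v * g x w w - g x v w ^ 2)

/-- `g` has a Levi-Civita connection, and its complex sectional curvature equals `k` on every
non-degenerate complex plane of every tangent space. -/
def HasConstantSectionalCurvature (g : BilinField E M) (k : ℂ) : Prop :=
  (∃ D : RealConnection E M, IsLeviCivita g D) ∧
    ∀ D : RealConnection E M, IsLeviCivita g D → ∀ (x : M) (v w : TangentSpace 𝓘(ℂ, E) x),
      SpansNondegeneratePlane g x v w → sectionalCurvature g D x v w = k

end HolomorphicRiemannian

/-! ### Lie groups and the Killing form -/

section LieGroups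

variable {E : Type*} [NormedAddCommGroup E] [NormedSpace ℂ E] [CompleteSpace E]
  {G : Type*} [TopologicalSpace G] [ChartedSpace E G] [Group G]

/-- A vector field is left-invariant if `(L_a)_* X = X` for all left translations `L_a`. -/
def IsLeftInvariant (X : RealField E G) : Prop :=
  ∀ a b : G, mfderiv 𝓘(ℝ, E) 𝓘(ℝ, E) (fun y : G => a * y) b (X b) = X (a * b)

/-- The global Killing form `Kill_a(u, v) = Kill(d(L_a⁻¹) u, d(L_a⁻¹) v)`. -/
def globalKilling (E : Type*) [NormedAddCommGroup E] [NormedSpace ℂ E] [CompleteSpace E]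
    (G : Type*) [TopologicalSpace G] [ChartedSpace E G] [Group G]
    [LieGroup 𝓘(ℂ, E) (minSmoothness ℂ 3) G] : BilinField E G := fun a =>
  let L : TangentSpace 𝓘(ℂ, E) a →ₗ[ℂ] GroupLieAlgebra 𝓘(ℂ, E) G :=
    (mfderiv 𝓘(ℂ, E) 𝓘(ℂ, E) (fun y : G => a⁻¹ * y) a).toLinearMap
  (killingForm ℂ (GroupLieAlgebra 𝓘(ℂ, E) G)).compl₁₂ L L

end LieGroups

/-- The Lie algebra of `PSL(2,ℂ)`: its tangent space at `1` with the bracket of left-invariant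
vector fields. -/
abbrev PSL2C.lieAlgebra : Type := GroupLieAlgebra 𝓘(ℂ, TracelessMat) PSL2C

/-- The metric of `PSL(2,ℂ)`: one eighth of the global Killing form. -/
def pslMetric : BilinField TracelessMat PSL2C :=
  fun A => (1 / 8 : ℂ) • globalKilling TracelessMat PSL2C A

/-- The metric of `SL(2,ℂ)`: the pull-back of the one of `PSL(2,ℂ)`. -/
def slMetric : BilinField TracelessMat SL2C := fun A =>
  let P : TangentSpace 𝓘(ℂ, TracelessMat) A →ₗ[ℂ] TangentSpace 𝓘(ℂ, TracelessMat) (slToPSL A) :=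
    (mfderiv 𝓘(ℂ, TracelessMat) 𝓘(ℂ, TracelessMat) slToPSL A).toLinearMap
  (pslMetric (slToPSL A)).compl₁₂ P P

end

/-! The metric is bi-invariant, and everything follows from an explicit formula for its Levi-Civita
connection. Left translation trivializes the tangent bundle, so a vector field becomes a function `G
→ T_1 G`. In this picture `symmConnection` is `D_X Y = dY(X) + ½ [X, Y]`. It is torsion free because
torsion is a tensor and vanishes on left-invariant fields. It preserves a left-invariant metric with
value `B` at `1` whenever every `ad u` is skew for `B`, since the two bracket terms then cancel
(`IsLeftInvariantMetric.isLeviCivita`). The difference of two Levi-Civita connections gives a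
trilinear expression symmetric in two slots and skew in two, hence zero (`IsLeviCivita.unique`). So
every Levi-Civita connection agrees with `symmConnection` on differentiable fields.

For the curvature, tangent vectors are extended by fields constant in a chart. These commute, second
derivatives cancel by symmetry, and the Maurer-Cartan equation together with the Jacobi identity
leaves `-¼ [[u, v], w]` (`leftTriv_curvature`). By skewness, `⟨R(v, w) w, v⟩ = ¼ ‖[v, w]‖²`, so
constant curvature `-1` is equivalent to the norm identity in assertion 3.

What remains is concrete. Connections and curvature are real objects while the Killing form is
complex, so real and complex differentials and brackets are first identified
(`lieBilin_real_eq_complex`). Differentiating the multiplication in the chart at `1` identifies the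
Lie bracket with the matrix commutator (`TracelessMat.lieBilin_eq`). Then the Killing form is `4
tr(uv)`, the metric at `1` is `halfTrace`, i.e. `½ tr(uv)`, and skewness and the norm identity are
polynomial identities in matrix entries. For `SL(2,ℂ)` the projection has identity differential in
the preferred charts, so its metric is given by the same form. -/

noncomputable section

/-! ### Left trivialization of the tangent bundle of a Lie group -/

section LeftTrivialization

variable {𝕜 : Type*} [RCLike 𝕜] {E : Type*} [NormedAddCommGroup E] [NormedSpace 𝕜 E]

/-- The point of the tangent bundle with base point `p` and vector `v`. -/
def tangentMk (𝕜 : Type*) [RCLike 𝕜] {E : Type*} [NormedAddCommGroup E] [NormedSpace 𝕜 E]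
    {G : Type*} [TopologicalSpace G] [ChartedSpace E G] (p : G) (v : E) :
    TangentBundle 𝓘(𝕜, E) G := ⟨p, v⟩

section Basic

variable {G : Type*} [TopologicalSpace G] [ChartedSpace E G]

/-- The tangent space at `p` is a copy of `E` read in the preferred chart at `p`, so the coordinate
change from that chart to itself is the identity. -/
theorem trivializationAt_tangentMk_self [IsManifold 𝓘(𝕜, E) 1 G] (p : G) (v : E) :
    (trivializationAt E (TangentSpace 𝓘(𝕜, E) : G → Type _) p (tangentMk 𝕜 p v)).2 = v := by
  change tangentCoordChange 𝓘(𝕜, E) p p p v = v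
  exact tangentCoordChange_self (mem_extChartAt_source p)

variable {F : Type*} [NormedAddCommGroup F] [NormedSpace 𝕜 F]
  {M : Type*} [TopologicalSpace M] [ChartedSpace F M]

theorem contMDiffAt_tangentMk_const_iff [IsManifold 𝓘(𝕜, E) 1 G]
    {n : ℕ∞ω} {w : M → E} (p : G) {x : M} :
    ContMDiffAt 𝓘(𝕜, F) 𝓘(𝕜, E).tangent n (fun y => tangentMk 𝕜 p (w y)) x ↔
      ContMDiffAt 𝓘(𝕜, F) 𝓘(𝕜, E) n w x := by
  refine Bundle.contMDiffAt_totalSpace.trans ?_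
  have h : ∀ y, (trivializationAt E (TangentSpace 𝓘(𝕜, E) : G → Type _) p
      (tangentMk 𝕜 p (w y))).2 = w y := fun y => trivializationAt_tangentMk_self p (w y)
  change ContMDiffAt _ _ n (fun _ => p) x ∧ ContMDiffAt _ _ n (fun y => (trivializationAt E
    (TangentSpace 𝓘(𝕜, E) : G → Type _) p (tangentMk 𝕜 p (w y))).2) x ↔ _
  simp only [h]
  exact and_iff_right contMDiffAt_const

theorem mdifferentiableAt_tangentMk_const_iff [IsManifold 𝓘(𝕜, E) 1 G]
    {w : M → E} (p : G) {x : M} :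
    MDifferentiableAt 𝓘(𝕜, F) 𝓘(𝕜, E).tangent (fun y => tangentMk 𝕜 p (w y)) x ↔
      MDifferentiableAt 𝓘(𝕜, F) 𝓘(𝕜, E) w x := by
  refine (mdifferentiableAt_totalSpace _ _).trans ?_
  have h : ∀ y, (trivializationAt E (TangentSpace 𝓘(𝕜, E) : G → Type _) p
      (tangentMk 𝕜 p (w y))).2 = w y := fun y => trivializationAt_tangentMk_self p (w y)
  change MDifferentiableAt _ _ (fun _ => p) x ∧ MDifferentiableAt _ _ (fun y => (trivializationAt E
    (TangentSpace 𝓘(𝕜, E) : G → Type _) p (tangentMk 𝕜 p (w y))).2) x ↔ _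
  simp only [h]
  exact and_iff_right mdifferentiableAt_const

end Basic

variable {G : Type*} [TopologicalSpace G] [ChartedSpace E G] [Group G]

variable (𝕜 E) in
/-- The differential `T_b G → T_{ab} G` of the left translation by `a`. -/
def mulLeftDeriv (a b : G) : E →L[𝕜] E :=
  (mfderiv 𝓘(𝕜, E) 𝓘(𝕜, E) (fun y : G => a * y) b)

variable (𝕜 E) in
/-- The left trivialization `T_a G → T_1 G`. -/
def leftTriv (a : G) : E →L[𝕜] E :=
  mulLeftDeriv 𝕜 E a⁻¹ a

variable (𝕜 E) in
/-- The differential `T_1 G → T_a G` of the left translation by `a`. -/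
def leftTrivSymm (a : G) : E →L[𝕜] E :=
  mulLeftDeriv 𝕜 E a 1

theorem mulLeftDeriv_one (c : G) (v : E) : mulLeftDeriv 𝕜 E 1 c v = v := by
  have h : (fun y : G => 1 * y) = id := by ext y; simp
  unfold mulLeftDeriv
  rw [h, mfderiv_id]
  rfl

theorem leftTriv_one (v : E) : leftTriv 𝕜 E (1 : G) v = v := by
  have := mulLeftDeriv_one (𝕜 := 𝕜) (1 : G) v
  unfold leftTriv
  rw [inv_one]
  exact this

/-- The points `a⁻¹ * a` and `1` are equal but not by definition. Stating the identity in the total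
space lets the base point be rewritten without transporting vectors. -/
theorem tangentMk_leftTriv (a : G) (v : E) :
    tangentMk 𝕜 (a⁻¹ * a) (mulLeftDeriv 𝕜 E a⁻¹ a v) =
      tangentMk 𝕜 (1 : G) (leftTriv 𝕜 E a v) := by
  rw [inv_mul_cancel]; rfl

theorem tangentMk_leftTrivSymm (a : G) (v : E) :
    tangentMk 𝕜 (a * 1) (mulLeftDeriv 𝕜 E a 1 v) =
      tangentMk 𝕜 a (leftTrivSymm 𝕜 E a v) := by
  rw [mul_one]; rfl

variable [LieGroup 𝓘(𝕜, E) ω G]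

/-- Chain rule for left translations. -/
theorem mulLeftDeriv_mul (a b c : G) (v : E) :
    mulLeftDeriv 𝕜 E (a * b) c v =
      mulLeftDeriv 𝕜 E a (b * c) (mulLeftDeriv 𝕜 E b c v) := by
  have h : (fun y : G => a * b * y) = (fun y => a * y) ∘ (fun y => b * y) := by
    ext y; simp [mul_assoc]
  have hd : ∀ a b : G, MDifferentiableAt 𝓘(𝕜, E) 𝓘(𝕜, E) (fun y : G => a * y) b := fun a b =>
    (contMDiff_mul_left (I := 𝓘(𝕜, E)) (n := ω)).contMDiffAt.mdifferentiableAt (by simp)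
  have := mfderiv_comp c (hd a (b * c)) (hd b c)
  unfold mulLeftDeriv
  rw [h, this]
  rfl

theorem leftTrivSymm_leftTriv (a : G) (v : E) : leftTrivSymm 𝕜 E a (leftTriv 𝕜 E a v) = v := by
  have := mulLeftDeriv_mul (𝕜 := 𝕜) a a⁻¹ a v
  rw [mul_inv_cancel, mulLeftDeriv_one, inv_mul_cancel] at this
  exact this.symm

theorem leftTriv_leftTrivSymm (a : G) (v : E) : leftTriv 𝕜 E a (leftTrivSymm 𝕜 E a v) = v := by
  have := mulLeftDeriv_mul (𝕜 := 𝕜) a⁻¹ a 1 v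
  rw [inv_mul_cancel, mulLeftDeriv_one] at this
  have h : mulLeftDeriv 𝕜 E a⁻¹ (a * 1) = leftTriv 𝕜 E a := by
    rw [mul_one]; rfl
  rw [h] at this
  exact this.symm

theorem leftTriv_injective (a : G) : Function.Injective (leftTriv 𝕜 E a) :=
  Function.LeftInverse.injective (leftTrivSymm_leftTriv a)

/-- Left translation of tangent vectors, as a map `G × TG → TG`, is analytic. -/
theorem contMDiff_leftTranslate_tangent :
    ContMDiff (𝓘(𝕜, E).prod 𝓘(𝕜, E).tangent) 𝓘(𝕜, E).tangent ω
      (fun p : G × TangentBundle 𝓘(𝕜, E) G => (tangentMk (E := E) 𝕜 (p.1 * p.2.1)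
        (mulLeftDeriv 𝕜 E p.1 p.2.1 p.2.2) :
          TangentBundle 𝓘(𝕜, E) G)) := by
  -- Left translation of `V` by `a` is the differential of multiplication applied to the pair `(0_a,
  -- V)`, so it is a composite of the zero section, `T G × T G ≅ T(G × G)` and a tangent map.
  have h₁ : ContMDiff (𝓘(𝕜, E).prod 𝓘(𝕜, E).tangent) 𝓘(𝕜, E).tangent ω
      (fun p : G × TangentBundle 𝓘(𝕜, E) G =>
        (Bundle.zeroSection E (TangentSpace 𝓘(𝕜, E) : G → Type _) p.1)) :=
    (Bundle.contMDiff_zeroSection 𝕜 (TangentSpace 𝓘(𝕜, E) : G → Type _)).comp contMDiff_fst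
  have h₂ := h₁.prodMk (contMDiff_snd (n := ω) (I := 𝓘(𝕜, E)) (J := 𝓘(𝕜, E).tangent)
    (M := G) (N := TangentBundle 𝓘(𝕜, E) G))
  have h₃ : ContMDiff (𝓘(𝕜, E).prod 𝓘(𝕜, E)).tangent 𝓘(𝕜, E).tangent ω
      (tangentMap (𝓘(𝕜, E).prod 𝓘(𝕜, E)) 𝓘(𝕜, E) (fun p : G × G => p.1 * p.2)) :=
    (contMDiff_mul 𝓘(𝕜, E) ω).contMDiff_tangentMap (by simp)
  have h₄ := (h₃.comp (contMDiff_equivTangentBundleProd_symm (n := ω))).comp h₂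
  refine h₄.congr fun p => ?_
  -- The differential of multiplication splits into two partial differentials, and the first one is
  -- evaluated at the zero vector.
  have := mfderiv_prod_eq_add_apply (E := E) (E' := E) (I := 𝓘(𝕜, E)) (I' := 𝓘(𝕜, E))
      (p := (p.1, p.2.1)) (v := ((0, p.2.2) : E × E))
      ((contMDiff_mul (G := G) 𝓘(𝕜, E) ω).mdifferentiable (by simp) (p.1, p.2.1))
  refine congrArg (tangentMk (E := E) 𝕜 (p.1 * p.2.1)) (Eq.trans ?_ this.symm)
  exact ((congrArg₂ (· + ·) (map_zero (mfderiv 𝓘(𝕜, E) 𝓘(𝕜, E)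
    (fun z : G => z * p.2.1) p.1 : E →L[𝕜] E)) rfl).trans (zero_add _)).symm

theorem contMDiffAt_leftTriv {n : ℕ∞ω} {Z : G → E} {x : G}
    (h : ContMDiffAt 𝓘(𝕜, E) 𝓘(𝕜, E).tangent n (fun y => tangentMk 𝕜 y (Z y)) x) :
    ContMDiffAt 𝓘(𝕜, E) 𝓘(𝕜, E) n (fun y => leftTriv 𝕜 E y (Z y)) x := by
  rw [← contMDiffAt_tangentMk_const_iff (1 : G)]
  have hi : ContMDiffAt 𝓘(𝕜, E) 𝓘(𝕜, E) n (fun y : G => y⁻¹) x :=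
    ((contMDiff_inv 𝓘(𝕜, E) ω).of_le le_top).contMDiffAt
  have := (contMDiff_leftTranslate_tangent (𝕜 := 𝕜) (E := E) (G := G)).of_le
    (le_top (a := n)) |>.contMDiffAt.comp x (hi.prodMk h)
  refine this.congr_of_eventuallyEq (Filter.Eventually.of_forall fun y => ?_)
  exact (tangentMk_leftTriv (𝕜 := 𝕜) y (Z y)).symm

/-- Both the trivialization and its inverse are left translations, hence analytic. This allows
differentiability of fields to be tested on functions with values in `T_1 G`. -/
theorem mdifferentiableAt_leftTriv_iff {Z : G → E} {x : G} :
    MDifferentiableAt 𝓘(𝕜, E) 𝓘(𝕜, E) (fun y => leftTriv 𝕜 E y (Z y)) x ↔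
      MDifferentiableAt 𝓘(𝕜, E) 𝓘(𝕜, E).tangent (fun y => tangentMk 𝕜 y (Z y)) x := by
  have hT := (contMDiff_leftTranslate_tangent (𝕜 := 𝕜) (E := E) (G := G)).mdifferentiable
    (by simp)
  rw [← mdifferentiableAt_tangentMk_const_iff (1 : G)]
  constructor <;> intro h
  · refine ((hT _).comp x (mdifferentiableAt_id.prodMk h)).congr_of_eventuallyEq
      (Filter.Eventually.of_forall fun y => ?_)
    refine Eq.trans ?_ (tangentMk_leftTrivSymm (𝕜 := 𝕜) y (leftTriv 𝕜 E y (Z y))).symm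
    rw [leftTrivSymm_leftTriv]
  · have hi : MDifferentiableAt 𝓘(𝕜, E) 𝓘(𝕜, E) (fun y : G => y⁻¹) x :=
      (contMDiff_inv 𝓘(𝕜, E) ω).mdifferentiable (by simp) x
    refine ((hT _).comp x (hi.prodMk h)).congr_of_eventuallyEq
      (Filter.Eventually.of_forall fun y => ?_)
    exact (tangentMk_leftTriv (𝕜 := 𝕜) y (Z y)).symm

end LeftTrivialization

/-! ### Vector fields which are constant in a chart -/

section ConstantInChart

variable {𝕜 : Type*} [RCLike 𝕜] {E : Type*} [NormedAddCommGroup E] [NormedSpace 𝕜 E]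
  {F : Type*} [NormedAddCommGroup F] [NormedSpace 𝕜 F]
  {M : Type*} [TopologicalSpace M] [ChartedSpace E M]

variable (𝕜 E) in
/-- The derivative of a vector valued function on a manifold, in the preferred chart. -/
def chartDeriv (f : M → F) (x : M) : E →L[𝕜] F := mfderiv 𝓘(𝕜, E) 𝓘(𝕜, F) f x

variable [IsManifold 𝓘(𝕜, E) ω M]

/-- `FiberBundle.extend` keeps the fibre coordinate in the trivialization at `x` constant, and that
coordinate of `u` is `u` itself. -/
theorem extend_eq_symmL {x y : M} (hy : y ∈ (chartAt E x).source)
    (u : TangentSpace 𝓘(𝕜, E) x) :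
    FiberBundle.extend E u y =
      (trivializationAt E (TangentSpace 𝓘(𝕜, E)) x).symmL 𝕜 y u := by
  have h := trivializationAt_tangentMk_self (𝕜 := 𝕜) (E := E) x u
  refine Eq.trans ?_ (congrArg ((trivializationAt E (TangentSpace 𝓘(𝕜, E)) x).symmL 𝕜 y) h)
  exact (Bundle.Trivialization.symmL_apply _ hy _).symm

theorem extend_eq_mfderiv {x y : M} (hy : y ∈ (chartAt E x).source)
    (u : TangentSpace 𝓘(𝕜, E) x) :
    (FiberBundle.extend E u y : E) = (mfderiv 𝓘(𝕜, E) 𝓘(𝕜, E) (extChartAt 𝓘(𝕜, E) x).symm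
      (extChartAt 𝓘(𝕜, E) x y) : E →L[𝕜] E) u := by
  have h := TangentBundle.symmL_trivializationAt (I := 𝓘(𝕜, E)) hy
  simp only [modelWithCornersSelf_coe, Set.range_id, mfderivWithin_univ] at h
  rw [extend_eq_symmL hy]
  exact congrArg (fun L : E →L[𝕜] E => L u) h

theorem mdifferentiableAt_extChartAt_symm {x y : M} (hy : y ∈ (chartAt E x).source) :
    MDifferentiableAt 𝓘(𝕜, E) 𝓘(𝕜, E) (extChartAt 𝓘(𝕜, E) x).symm (extChartAt 𝓘(𝕜, E) x y) := by
  have hy' : y ∈ (extChartAt 𝓘(𝕜, E) x).source := by simpa using hy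
  have := (contMDiffOn_extChartAt_symm (I := 𝓘(𝕜, E)) (n := ω) x).contMDiffAt
    (extChartAt_target_mem_nhds' ((extChartAt 𝓘(𝕜, E) x).map_source hy'))
  exact this.mdifferentiableAt (by simp)

theorem chartDeriv_extend {x y : M} (hy : y ∈ (chartAt E x).source)
    (u : TangentSpace 𝓘(𝕜, E) x) {f : M → F} (hf : MDifferentiableAt 𝓘(𝕜, E) 𝓘(𝕜, F) f y) :
    chartDeriv 𝕜 E f y (FiberBundle.extend E u y) =
      fderiv 𝕜 (f ∘ (extChartAt 𝓘(𝕜, E) x).symm) (extChartAt 𝓘(𝕜, E) x y) u := by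
  have h0 : (extChartAt 𝓘(𝕜, E) x).symm (extChartAt 𝓘(𝕜, E) x y) = y :=
    (extChartAt 𝓘(𝕜, E) x).left_inv (by simpa using hy)
  have hf' : MDifferentiableAt 𝓘(𝕜, E) 𝓘(𝕜, F) f
    ((extChartAt 𝓘(𝕜, E) x).symm (extChartAt 𝓘(𝕜, E) x y)) := by rwa [h0]
  have := mfderiv_comp (extChartAt 𝓘(𝕜, E) x y) hf' (mdifferentiableAt_extChartAt_symm hy)
  rw [mfderiv_eq_fderiv] at this
  have h2 := congrArg (fun L : E →L[𝕜] F => L u) this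
  refine Eq.trans ?_ h2.symm
  change _ = chartDeriv 𝕜 E f ((extChartAt 𝓘(𝕜, E) x).symm (extChartAt 𝓘(𝕜, E) x y))
    ((mfderiv 𝓘(𝕜, E) 𝓘(𝕜, E) (extChartAt 𝓘(𝕜, E) x).symm
      (extChartAt 𝓘(𝕜, E) x y) : E →L[𝕜] E) u)
  rw [← extend_eq_mfderiv hy, h0]

/-- The extension is the push-forward of a constant field under the inverse chart, whose derivative
is invertible on the chart target. -/
theorem mpullbackWithin_extend_eventuallyEq {x : M} (u : TangentSpace 𝓘(𝕜, E) x) :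
    (VectorField.mpullbackWithin 𝓘(𝕜, E) 𝓘(𝕜, E) (extChartAt 𝓘(𝕜, E) x).symm
      (FiberBundle.extend E u) (Set.range 𝓘(𝕜, E)) : E → E)
      =ᶠ[nhds (extChartAt 𝓘(𝕜, E) x x)] fun _ => (u : E) := by
  filter_upwards [extChartAt_target_mem_nhds (I := 𝓘(𝕜, E)) x] with p hp
  have hs : (extChartAt 𝓘(𝕜, E) x).symm p ∈ (chartAt E x).source := by
    simpa using (extChartAt 𝓘(𝕜, E) x).map_target hp
  have h1 := TangentBundle.symmL_trivializationAt (I := 𝓘(𝕜, E)) hs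
  obtain ⟨e, he⟩ := isInvertible_mfderivWithin_extChartAt_symm (I := 𝓘(𝕜, E)) hp
  rw [VectorField.mpullbackWithin_apply, extend_eq_symmL hs, h1,
    (extChartAt 𝓘(𝕜, E) x).right_inv hp,
    ← he, ContinuousLinearMap.inverse_equiv]
  exact e.symm_apply_apply u

/-- Constant fields on a vector space commute. This removes the term `D_[X,Y] Z` from
`curvatureTensor`. -/
theorem mlieBracket_extend {x : M} (u v : TangentSpace 𝓘(𝕜, E) x) :
    VectorField.mlieBracket 𝓘(𝕜, E) (FiberBundle.extend E u) (FiberBundle.extend E v) x = 0 := by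
  rw [← VectorField.mlieBracketWithin_univ, VectorField.mlieBracketWithin_apply]
  have hz : ∀ (u v : E) (s : Set E) (p : E),
      VectorField.lieBracketWithin 𝕜 (fun _ => u) (fun _ => v) s p = 0 := by
    simp [VectorField.lieBracketWithin]
  have h : VectorField.lieBracketWithin 𝕜
      (VectorField.mpullbackWithin 𝓘(𝕜, E) 𝓘(𝕜, E) (extChartAt 𝓘(𝕜, E) x).symm
        (FiberBundle.extend E u) (Set.range 𝓘(𝕜, E)) : E → E)
      (VectorField.mpullbackWithin 𝓘(𝕜, E) 𝓘(𝕜, E) (extChartAt 𝓘(𝕜, E) x).symm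
        (FiberBundle.extend E v) (Set.range 𝓘(𝕜, E)) : E → E)
      ((extChartAt 𝓘(𝕜, E) x).symm ⁻¹' Set.univ ∩ Set.range 𝓘(𝕜, E))
      (extChartAt 𝓘(𝕜, E) x x) = 0 := by
    rw [Filter.EventuallyEq.lieBracketWithin_vectorField_eq_nhds
      (mpullbackWithin_extend_eventuallyEq u) (mpullbackWithin_extend_eventuallyEq v)]
    exact hz u v _ _
  refine (congrArg _ h).trans ?_
  exact map_zero _

/-- Mixed derivatives along fields which are constant in a chart commute. -/
theorem chartDeriv_chartDeriv_extend {f : M → F} {x : M}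
    (hf : ContMDiffAt 𝓘(𝕜, E) 𝓘(𝕜, F) 2 f x) (u v : TangentSpace 𝓘(𝕜, E) x) :
    MDifferentiableAt 𝓘(𝕜, E) 𝓘(𝕜, F)
        (fun y => chartDeriv 𝕜 E f y (FiberBundle.extend E v y)) x ∧
      chartDeriv 𝕜 E (fun y => chartDeriv 𝕜 E f y (FiberBundle.extend E v y)) x u =
      chartDeriv 𝕜 E (fun y => chartDeriv 𝕜 E f y (FiberBundle.extend E u y)) x v := by
  set φ := extChartAt 𝓘(𝕜, E) x
  set g := f ∘ φ.symm
  have hg : ContDiffAt 𝕜 2 g (φ x) := by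
    have hs : ContMDiffAt 𝓘(𝕜, E) 𝓘(𝕜, E) 2 φ.symm (φ x) :=
      (contMDiffOn_extChartAt_symm (I := 𝓘(𝕜, E)) x).contMDiffAt
        (extChartAt_target_mem_nhds x)
    have hf' : ContMDiffAt 𝓘(𝕜, E) 𝓘(𝕜, F) 2 f (φ.symm (φ x)) := by
      rwa [extChartAt_to_inv]
    exact (hf'.comp _ hs).contDiffAt
  have hg' : DifferentiableAt 𝕜 (fderiv 𝕜 g) (φ x) :=
    (hg.fderiv_right (m := 1) (by norm_num)).differentiableAt (by simp)
  -- Near `x`, differentiating along the extension of `v` is the partial derivative of `g` in the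
  -- fixed direction `v`.
  have heq : ∀ v : E, (fun y => chartDeriv 𝕜 E f y
      (FiberBundle.extend E (show TangentSpace 𝓘(𝕜, E) x from v) y)) =ᶠ[nhds x]
      (fun p => fderiv 𝕜 g p v) ∘ φ := by
    intro v
    have hf1 := (contMDiffAt_iff_contMDiffAt_nhds (by simp)).mp
      (hf.of_le (m := 1) (by norm_num))
    filter_upwards [hf1, (chartAt E x).open_source.mem_nhds (mem_chart_source E x)] with y h1 h2
    exact chartDeriv_extend h2 _ (h1.mdifferentiableAt (by simp))
  have hd : ∀ v : E, MDifferentiableAt 𝓘(𝕜, E) 𝓘(𝕜, F) (fun p => fderiv 𝕜 g p v) (φ x) :=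
    fun v => (hg'.clm_apply (differentiableAt_const v)).mdifferentiableAt
  have hφ : MDifferentiableAt 𝓘(𝕜, E) 𝓘(𝕜, E) φ x :=
    (contMDiffAt_extChartAt (I := 𝓘(𝕜, E)) (n := ω)).mdifferentiableAt (by simp)
  have hdd : ∀ v, MDifferentiableAt 𝓘(𝕜, E) 𝓘(𝕜, F) (fun y => chartDeriv 𝕜 E f y
      (FiberBundle.extend E (show TangentSpace 𝓘(𝕜, E) x from v) y)) x := fun v =>
    ((hd v).comp x hφ).congr_of_eventuallyEq (heq v)
  -- The iterated derivative is thus the second Fréchet derivative of `g`, which is symmetric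
  -- because `g` is twice continuously differentiable.
  have hval : ∀ u v : E, chartDeriv 𝕜 E (fun y => chartDeriv 𝕜 E f y
      (FiberBundle.extend E (show TangentSpace 𝓘(𝕜, E) x from v) y)) x u =
      fderiv 𝕜 (fderiv 𝕜 g) (φ x) u v := by
    intro u v
    have h1 := chartDeriv_extend (mem_chart_source E x) (show TangentSpace 𝓘(𝕜, E) x from u)
      (hdd v)
    rw [FiberBundle.extend_apply_self] at h1
    refine h1.trans ?_
    have h2 : (fun y => chartDeriv 𝕜 E f y
      (FiberBundle.extend E (show TangentSpace 𝓘(𝕜, E) x from v) y)) ∘ φ.symm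
      =ᶠ[nhds (φ x)] fun p => fderiv 𝕜 g p v := by
      have hc : Filter.Tendsto φ.symm (nhds (φ x)) (nhds x) := by
        have := continuousAt_extChartAt_symm (I := 𝓘(𝕜, E)) x
        simpa [ContinuousAt, φ] using this
      filter_upwards [hc.eventually (heq v), extChartAt_target_mem_nhds (I := 𝓘(𝕜, E)) x]
        with p hp hp2
      refine hp.trans ?_
      rw [Function.comp_apply, φ.right_inv hp2]
    rw [h2.fderiv_eq, fderiv_clm_apply hg' (differentiableAt_const v)]
    simp
  refine ⟨hdd v, ?_⟩
  refine (hval u v).trans (Eq.trans ?_ (hval v u).symm)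
  have hsymm : IsSymmSndFDerivAt 𝕜 g (φ x) := hg.isSymmSndFDerivAt (by simp)
  exact hsymm u v

end ConstantInChart

/-! ### The symmetric left-invariant connection of a real Lie group -/

section ChartDeriv

variable {𝕜 : Type*} [RCLike 𝕜] {E : Type*} [NormedAddCommGroup E] [NormedSpace 𝕜 E]
  {F₁ F₂ F : Type*} [NormedAddCommGroup F₁] [NormedSpace 𝕜 F₁] [NormedAddCommGroup F₂]
  [NormedSpace 𝕜 F₂] [NormedAddCommGroup F] [NormedSpace 𝕜 F]
  {M : Type*} [TopologicalSpace M] [ChartedSpace E M] {x : M}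

theorem HasMFDerivAt.bilinear (B : F₁ →L[𝕜] F₂ →L[𝕜] F) {f : M → F₁} {g : M → F₂}
    (hf : MDifferentiableAt 𝓘(𝕜, E) 𝓘(𝕜, F₁) f x) (hg : MDifferentiableAt 𝓘(𝕜, E) 𝓘(𝕜, F₂) g x) :
    HasMFDerivAt 𝓘(𝕜, E) 𝓘(𝕜, F) (fun y => B (f y) (g y)) x
      (B.precompR E (f x) (chartDeriv 𝕜 E g x) + B.precompL E (chartDeriv 𝕜 E f x) (g x)) := by
  have h := ContinuousLinearMap.hasFDerivWithinAt_of_bilinear B hf.hasMFDerivAt.2 hg.hasMFDerivAt.2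
  refine ⟨(B.continuous.continuousAt.comp hf.continuousAt).clm_apply hg.continuousAt, ?_⟩
  have e1 : writtenInExtChartAt 𝓘(𝕜, E) 𝓘(𝕜, F₁) x f (extChartAt 𝓘(𝕜, E) x x) = f x := by
    simp only [mfld_simps]; rfl
  have e2 : writtenInExtChartAt 𝓘(𝕜, E) 𝓘(𝕜, F₂) x g (extChartAt 𝓘(𝕜, E) x x) = g x := by
    simp only [mfld_simps]; rfl
  rw [e1, e2] at h
  exact h

theorem chartDeriv_bilinear (B : F₁ →L[𝕜] F₂ →L[𝕜] F) {f : M → F₁} {g : M → F₂}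
    (hf : MDifferentiableAt 𝓘(𝕜, E) 𝓘(𝕜, F₁) f x) (hg : MDifferentiableAt 𝓘(𝕜, E) 𝓘(𝕜, F₂) g x)
    (u : E) :
    chartDeriv 𝕜 E (fun y => B (f y) (g y)) x u =
      B (f x) (chartDeriv 𝕜 E g x u) + B (chartDeriv 𝕜 E f x u) (g x) :=
  congrArg (fun L : E →L[𝕜] F => L u) (HasMFDerivAt.bilinear B hf hg).mfderiv

theorem chartDeriv_add {f g : M → F}
    (hf : MDifferentiableAt 𝓘(𝕜, E) 𝓘(𝕜, F) f x) (hg : MDifferentiableAt 𝓘(𝕜, E) 𝓘(𝕜, F) g x) :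
    chartDeriv 𝕜 E (fun y => f y + g y) x = chartDeriv 𝕜 E f x + chartDeriv 𝕜 E g x :=
  mfderiv_add hf hg

theorem chartDeriv_const_smul (c : 𝕜) {f : M → F}
    (hf : MDifferentiableAt 𝓘(𝕜, E) 𝓘(𝕜, F) f x) :
    chartDeriv 𝕜 E (fun y => c • f y) x = c • chartDeriv 𝕜 E f x :=
  const_smul_mfderiv hf c

theorem chartDeriv_const (c : F) : chartDeriv 𝕜 E (fun _ : M => c) x = 0 :=
  mfderiv_const

theorem Filter.EventuallyEq.chartDeriv_eq {f g : M → F} (h : f =ᶠ[nhds x] g) :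
    chartDeriv 𝕜 E f x = chartDeriv 𝕜 E g x :=
  h.mfderiv_eq

end ChartDeriv

/-! ### The Lie algebra bracket as a bilinear map on the model space -/

section LieBracket

variable (𝕜 : Type*) [RCLike 𝕜] (E : Type*) [NormedAddCommGroup E] [NormedSpace 𝕜 E]
  [CompleteSpace E] (G : Type*) [TopologicalSpace G] [ChartedSpace E G] [Group G]
  [LieGroup 𝓘(𝕜, E) ω G]

/-- The bracket of the Lie algebra of a Lie group as a bilinear map on the model space. -/
def lieLinear : E →ₗ[𝕜] E →ₗ[𝕜] E :=
  (LinearMap.mk₂ 𝕜 (fun u v => ⁅u, v⁆) add_lie smul_lie lie_add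
    (fun c u v => lie_smul c u v) : GroupLieAlgebra 𝓘(𝕜, E) G →ₗ[𝕜]
      GroupLieAlgebra 𝓘(𝕜, E) G →ₗ[𝕜] GroupLieAlgebra 𝓘(𝕜, E) G)

variable [FiniteDimensional 𝕜 E]

/-- The bracket of the Lie algebra of a Lie group as a continuous bilinear map on the model
space. -/
def lieBilin : E →L[𝕜] E →L[𝕜] E := (lieLinear 𝕜 E G).toContinuousBilinearMap

variable {𝕜 E G}

theorem lieBilin_swap (u v : E) : lieBilin 𝕜 E G u v = -lieBilin 𝕜 E G v u :=
  (lie_skew (L := GroupLieAlgebra 𝓘(𝕜, E) G) u v).symm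

theorem lieBilin_jacobi (u v w : E) : lieBilin 𝕜 E G (lieBilin 𝕜 E G u v) w =
    lieBilin 𝕜 E G u (lieBilin 𝕜 E G v w) - lieBilin 𝕜 E G v (lieBilin 𝕜 E G u w) :=
  lie_lie (L := GroupLieAlgebra 𝓘(𝕜, E) G) (M := GroupLieAlgebra 𝓘(𝕜, E) G) u v w

end LieBracket

section Connection

variable {E : Type*} [NormedAddCommGroup E] [NormedSpace ℝ E]
  {G : Type*} [TopologicalSpace G] [ChartedSpace E G] [Group G] [LieGroup 𝓘(ℝ, E) ω G]

/-- The function `G → T_1 G` given by a vector field in the left trivialization. -/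
def trivField (X : Π y : G, TangentSpace 𝓘(ℝ, E) y) (y : G) : E := leftTriv ℝ E y (X y)

theorem mdifferentiableAt_trivField_iff {X : Π y : G, TangentSpace 𝓘(ℝ, E) y} {x : G} :
    MDifferentiableAt 𝓘(ℝ, E) 𝓘(ℝ, E) (trivField X) x ↔
      MDifferentiableAt 𝓘(ℝ, E) 𝓘(ℝ, E).tangent (T% X) x :=
  mdifferentiableAt_leftTriv_iff

/-- The left-invariant vector field with value `v` at `1`. -/
def invField (v : E) : Π y : G, TangentSpace 𝓘(ℝ, E) y :=
  mulInvariantVectorField (I := 𝓘(ℝ, E)) (G := G) v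

theorem mdifferentiableAt_invField (v : E) (x : G) :
    MDifferentiableAt 𝓘(ℝ, E) 𝓘(ℝ, E).tangent (T% (invField (G := G) v)) x :=
  mdifferentiableAt_mulInvariantVectorField (I := 𝓘(ℝ, E)) (G := G) v

theorem trivField_invField (v : E) : trivField (invField (G := G) v) = fun _ => v :=
  funext fun y => leftTriv_leftTrivSymm (E := E) y v

theorem invField_leftTriv (x : G) (v : TangentSpace 𝓘(ℝ, E) x) :
    invField (leftTriv ℝ E x v) x = v :=
  leftTrivSymm_leftTriv (E := E) x v

variable [FiniteDimensional ℝ E] [CompleteSpace E]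

/-- The connection `D_X Y = dY(X) + ½ [X, Y]` in the left trivialization. -/
def symmConnection : CovariantDerivative 𝓘(ℝ, E) E (TangentSpace 𝓘(ℝ, E) : G → Type _) where
  toFun Y x := (leftTrivSymm ℝ E x).comp (chartDeriv ℝ E (trivField Y) x +
    (1 / 2 : ℝ) • ((lieBilin ℝ E G).flip (trivField Y x)).comp (leftTriv ℝ E x))
  isCovariantDerivativeOnUniv := {
    add := by
      intro Y Y' x hY hY' _
      rw [← mdifferentiableAt_trivField_iff] at hY hY'
      have h1 : trivField (Y + Y') = fun y => trivField Y y + trivField Y' y :=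
        funext fun y => map_add (leftTriv ℝ E y) (Y y) (Y' y)
      refine ContinuousLinearMap.ext fun u : E => ?_
      rw [h1, chartDeriv_add hY hY']
      change leftTrivSymm ℝ E x ((chartDeriv ℝ E _ x u + chartDeriv ℝ E _ x u) +
          (1 / 2 : ℝ) • lieBilin ℝ E G (leftTriv ℝ E x u) (trivField Y x + trivField Y' x)) =
        leftTrivSymm ℝ E x (chartDeriv ℝ E _ x u + (1 / 2 : ℝ) • lieBilin ℝ E G
          (leftTriv ℝ E x u) (trivField Y x)) +
        leftTrivSymm ℝ E x (chartDeriv ℝ E _ x u + (1 / 2 : ℝ) • lieBilin ℝ E G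
          (leftTriv ℝ E x u) (trivField Y' x))
      rw [← map_add, map_add (lieBilin ℝ E G (leftTriv ℝ E x u)), smul_add]
      congr 1
      abel
    leibniz := by
      intro Y g x hY hg _
      rw [← mdifferentiableAt_trivField_iff] at hY
      have h1 : trivField (g • Y) = fun y => ContinuousLinearMap.lsmul ℝ ℝ (g y) (trivField Y y) :=
        funext fun y => map_smul (leftTriv ℝ E y) (g y) (Y y)
      refine ContinuousLinearMap.ext fun u : E => ?_
      rw [h1]
      change leftTrivSymm ℝ E x (chartDeriv ℝ E _ x u + (1 / 2 : ℝ) • lieBilin ℝ E G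
          (leftTriv ℝ E x u) (g x • trivField Y x)) =
        g x • leftTrivSymm ℝ E x (chartDeriv ℝ E _ x u + (1 / 2 : ℝ) • lieBilin ℝ E G
          (leftTriv ℝ E x u) (trivField Y x)) + (chartDeriv ℝ E g x u) • (show E from Y x)
      rw [chartDeriv_bilinear (ContinuousLinearMap.lsmul ℝ ℝ) hg hY]
      have h2 : (show E from Y x) = leftTrivSymm ℝ E x (trivField Y x) :=
        (leftTrivSymm_leftTriv (E := E) x _).symm
      rw [h2, ← map_smul (leftTrivSymm ℝ E x), ← map_smul (leftTrivSymm ℝ E x), ← map_add]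
      simp only [ContinuousLinearMap.lsmul_apply, map_smul, smul_add]
      congr 1
      rw [smul_comm (g x)]
      abel }

theorem leftTriv_symmConnection (Y : Π y : G, TangentSpace 𝓘(ℝ, E) y) (x : G)
    (u : TangentSpace 𝓘(ℝ, E) x) :
    leftTriv ℝ E x (symmConnection Y x u) = chartDeriv ℝ E (trivField Y) x u +
      (1 / 2 : ℝ) • lieBilin ℝ E G (leftTriv ℝ E x u) (trivField Y x) :=
  leftTriv_leftTrivSymm (E := E) x _

theorem mlieBracket_invField (v w : E) :
    VectorField.mlieBracket 𝓘(ℝ, E) (invField (G := G) v) (invField w) =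
      invField (lieBilin ℝ E G v w) :=
  (mulInvariantVector_mlieBracket (I := 𝓘(ℝ, E)) (G := G) v w).symm

/-- A left-invariant field is constant in the left trivialization, so the derivative term vanishes
and only half the bracket is left. -/
theorem symmConnection_invField (v w : E) (x : G) :
    symmConnection (invField w) x (invField v x) =
      (1 / 2 : ℝ) • VectorField.mlieBracket 𝓘(ℝ, E) (invField v) (invField w) x := by
  apply leftTriv_injective (𝕜 := ℝ) (E := E) x
  rw [leftTriv_symmConnection, trivField_invField, chartDeriv_const, mlieBracket_invField]
  refine Eq.trans ?_ (map_smul (leftTriv ℝ E x) (1 / 2 : ℝ) _).symm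
  refine (zero_add _).trans (congrArg _ ?_)
  refine Eq.trans ?_ (leftTriv_leftTrivSymm (E := E) x _).symm
  exact congrArg (fun z => lieBilin ℝ E G z w) (leftTriv_leftTrivSymm (E := E) x v)

/-- Torsion is a tensor and every tangent vector is the value of a left-invariant field. On such
fields it is `½ [X, Y] - ½ [Y, X] - [X, Y] = 0`. -/
theorem symmConnection_torsion (x : G) :
    (symmConnection (E := E) (G := G)).torsion x = 0 := by
  refine ContinuousLinearMap.ext fun u => ContinuousLinearMap.ext fun v => ?_
  rw [← invField_leftTriv x u, ← invField_leftTriv x v,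
    CovariantDerivative.torsion_apply _ (mdifferentiableAt_invField _ x)
    (mdifferentiableAt_invField _ x), symmConnection_invField,
    symmConnection_invField, VectorField.mlieBracket_swap]
  simp only [Pi.neg_apply, zero_apply]
  module

theorem symmConnection_torsionFree {X Y : Π y : G, TangentSpace 𝓘(ℝ, E) y} {x : G}
    (hX : MDifferentiableAt 𝓘(ℝ, E) 𝓘(ℝ, E).tangent (T% X) x)
    (hY : MDifferentiableAt 𝓘(ℝ, E) 𝓘(ℝ, E).tangent (T% Y) x) :
    symmConnection Y x (X x) - symmConnection X x (Y x) =
      VectorField.mlieBracket 𝓘(ℝ, E) X Y x :=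
  (CovariantDerivative.torsion_eq_zero_iff _).mp (funext symmConnection_torsion) hX hY

end Connection

/-! ### Curvature of the symmetric connection -/

section Curvature

variable {E : Type*} [NormedAddCommGroup E] [NormedSpace ℝ E]
  {G : Type*} [TopologicalSpace G] [ChartedSpace E G] [Group G] [LieGroup 𝓘(ℝ, E) ω G]

theorem contMDiffAt_trivField_extend {x : G} (u : TangentSpace 𝓘(ℝ, E) x) :
    ContMDiffAt 𝓘(ℝ, E) 𝓘(ℝ, E) 2 (trivField (FiberBundle.extend E u)) x :=
  contMDiffAt_leftTriv (𝕜 := ℝ) (FiberBundle.contMDiffAt_extend 𝓘(ℝ, E) E u)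

theorem eventually_mdifferentiableAt_extend {x : G} (u : TangentSpace 𝓘(ℝ, E) x) :
    ∀ᶠ y in nhds x, MDifferentiableAt 𝓘(ℝ, E) 𝓘(ℝ, E).tangent (T% (FiberBundle.extend E u)) y := by
  obtain ⟨s, hs, h⟩ := FiberBundle.exists_contMDiffOn_extend (k := 1) 𝓘(ℝ, E) E u
  filter_upwards [eventually_mem_nhds_iff.mpr hs] with y hy
  exact (h.contMDiffAt hy).mdifferentiableAt one_ne_zero

theorem trivField_extend_self {x : G} (u : TangentSpace 𝓘(ℝ, E) x) :
    trivField (FiberBundle.extend E u) x = leftTriv ℝ E x u :=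
  congrArg (leftTriv ℝ E x) (FiberBundle.extend_apply_self E u)

variable [FiniteDimensional ℝ E] [CompleteSpace E]

/-- The Maurer-Cartan equation for fields which are constant in a chart. -/
theorem chartDeriv_trivField_extend {x : G} (u v : TangentSpace 𝓘(ℝ, E) x) :
    chartDeriv ℝ E (trivField (FiberBundle.extend E v)) x u =
      chartDeriv ℝ E (trivField (FiberBundle.extend E u)) x v -
        lieBilin ℝ E G (leftTriv ℝ E x u) (leftTriv ℝ E x v) := by
  -- The two extensions commute, so vanishing torsion says `D_U V = D_V U` at `x`. Written in the
  -- trivialization, the two halves of the bracket add up to the Maurer-Cartan term.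
  have h := symmConnection_torsionFree (FiberBundle.mdifferentiableAt_extend 𝓘(ℝ, E) E u)
    (FiberBundle.mdifferentiableAt_extend 𝓘(ℝ, E) E v)
  rw [mlieBracket_extend, sub_eq_zero, FiberBundle.extend_apply_self,
    FiberBundle.extend_apply_self] at h
  have h' := congrArg (leftTriv ℝ E x) h
  rw [leftTriv_symmConnection, leftTriv_symmConnection, trivField_extend_self,
    trivField_extend_self, lieBilin_swap (leftTriv ℝ E x v)] at h'
  rw [smul_neg, ← sub_eq_add_neg] at h'
  rw [eq_sub_of_add_eq h', sub_sub, ← add_smul]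
  norm_num

/-- A connection which agrees with `symmConnection` has curvature `-¼ [[u, v], w]`. -/
theorem leftTriv_curvature {D : CovariantDerivative 𝓘(ℝ, E) E (TangentSpace 𝓘(ℝ, E) : G → Type _)}
    (hD : ∀ (Y : Π y : G, TangentSpace 𝓘(ℝ, E) y) (y : G),
      MDifferentiableAt 𝓘(ℝ, E) 𝓘(ℝ, E).tangent (T% Y) y → D Y y = symmConnection Y y)
    {x : G} (u v w : TangentSpace 𝓘(ℝ, E) x) :
    leftTriv ℝ E x (D (fun y => D (FiberBundle.extend E w) y (FiberBundle.extend E v y)) x u -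
        D (fun y => D (FiberBundle.extend E w) y (FiberBundle.extend E u y)) x v) =
      -((1 / 4 : ℝ) • lieBilin ℝ E G (lieBilin ℝ E G (leftTriv ℝ E x u) (leftTriv ℝ E x v))
        (leftTriv ℝ E x w)) := by
  set ζ := trivField (FiberBundle.extend E w) with hζ
  have hd : ∀ v : TangentSpace 𝓘(ℝ, E) x, MDifferentiableAt 𝓘(ℝ, E) 𝓘(ℝ, E)
      (trivField (FiberBundle.extend E v)) x := fun v =>
    (contMDiffAt_trivField_extend v).mdifferentiableAt (by simp)
  -- The second covariant derivative in the trivialization, expanded by the product rule. It is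
  -- stated for all `u` and `v` so that it can be antisymmetrized.
  have key : ∀ u v : TangentSpace 𝓘(ℝ, E) x,
      leftTriv ℝ E x (D (fun y => D (FiberBundle.extend E w) y (FiberBundle.extend E v y)) x u) =
      chartDeriv ℝ E (fun y => chartDeriv ℝ E ζ y (FiberBundle.extend E v y)) x u +
      (1 / 2 : ℝ) • (lieBilin ℝ E G (leftTriv ℝ E x v) (chartDeriv ℝ E ζ x u) +
        lieBilin ℝ E G (chartDeriv ℝ E (trivField (FiberBundle.extend E v)) x u)
          (leftTriv ℝ E x w)) +
      (1 / 2 : ℝ) • lieBilin ℝ E G (leftTriv ℝ E x u) (chartDeriv ℝ E ζ x v +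
        (1 / 2 : ℝ) • lieBilin ℝ E G (leftTriv ℝ E x v) (leftTriv ℝ E x w)) := by
    intro u v
    obtain ⟨h1, -⟩ := chartDeriv_chartDeriv_extend (contMDiffAt_trivField_extend w) u v
    have h2 : MDifferentiableAt 𝓘(ℝ, E) 𝓘(ℝ, E) (fun y => lieBilin ℝ E G
        (trivField (FiberBundle.extend E v) y) (ζ y)) x :=
      (HasMFDerivAt.bilinear (lieBilin ℝ E G) (hd v) (hd w)).mdifferentiableAt
    have h3 : MDifferentiableAt 𝓘(ℝ, E) 𝓘(ℝ, E) (fun y => (1 / 2 : ℝ) • lieBilin ℝ E G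
        (trivField (FiberBundle.extend E v) y) (ζ y)) x := h2.const_smul _
    -- The inner derivative is differentiated once more, so its formula is needed on a neighbourhood
    -- of `x`, where the extension of `w` stays differentiable.
    have hω : trivField (fun y => D (FiberBundle.extend E w) y (FiberBundle.extend E v y))
        =ᶠ[nhds x] fun y => chartDeriv ℝ E ζ y (FiberBundle.extend E v y) +
          (1 / 2 : ℝ) • lieBilin ℝ E G (trivField (FiberBundle.extend E v) y) (ζ y) := by
      filter_upwards [eventually_mdifferentiableAt_extend w] with y hy
      refine Eq.trans ?_ (leftTriv_symmConnection (FiberBundle.extend E w) y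
        (FiberBundle.extend E v y))
      rw [← hD _ y hy]
      rfl
    have hdiff := (h1.add h3).congr_of_eventuallyEq hω
    rw [hD _ x (mdifferentiableAt_trivField_iff.mp hdiff), leftTriv_symmConnection,
      hω.chartDeriv_eq, chartDeriv_add h1 h3, chartDeriv_const_smul _ h2, hω.eq_of_nhds,
      trivField_extend_self, FiberBundle.extend_apply_self, hζ, trivField_extend_self]
    have h5 := chartDeriv_bilinear (lieBilin ℝ E G) (hd v) (hd w) u
    rw [trivField_extend_self, trivField_extend_self] at h5
    exact congrArg (fun z : E => _ + (1 / 2 : ℝ) • z + _) h5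
  obtain ⟨-, hA⟩ := chartDeriv_chartDeriv_extend (contMDiffAt_trivField_extend w) u v
  refine (map_sub (leftTriv ℝ E x) _ _).trans ?_
  refine (congrArg₂ _ (key u v) (key v u)).trans ?_
  -- After antisymmetrization the second derivatives and the terms in `dζ` cancel. Maurer-Cartan
  -- contributes `-½ [[u, v], w]`, and the double brackets give `¼ [[u, v], w]` by Jacobi.
  rw [hA, chartDeriv_trivField_extend u v, lieBilin_jacobi]
  simp only [map_sub, map_add, map_smul, FunLike.coe_sub, Pi.sub_apply, lieBilin_jacobi]
  module

end Curvature

/-! ### The Lie bracket in a chart -/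

section ChartField

variable {𝕜 : Type*} [RCLike 𝕜] {E : Type*} [NormedAddCommGroup E] [NormedSpace 𝕜 E]
  {M : Type*} [TopologicalSpace M] [ChartedSpace E M]

variable (𝕜) in
/-- A vector field read in the preferred chart at `x`. -/
def chartField (x : M) (V : M → E) (p : E) : E :=
  ContinuousLinearMap.inverse
    (mfderiv 𝓘(𝕜, E) 𝓘(𝕜, E) (extChartAt 𝓘(𝕜, E) x).symm p : E →L[𝕜] E)
    (V ((extChartAt 𝓘(𝕜, E) x).symm p))

theorem mpullbackWithin_eq_chartField (V : Π y : M, TangentSpace 𝓘(𝕜, E) y) (x : M) :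
    VectorField.mpullbackWithin 𝓘(𝕜, E) 𝓘(𝕜, E) (extChartAt 𝓘(𝕜, E) x).symm V
      (Set.range 𝓘(𝕜, E)) = chartField 𝕜 x V := by
  ext p
  rw [VectorField.mpullbackWithin_apply]
  simp only [modelWithCornersSelf_coe, Set.range_id, mfderivWithin_univ]
  rfl

variable [IsManifold 𝓘(𝕜, E) ω M]

theorem isInvertible_mfderiv_chart_symm {x : M} {p : E}
    (hp : p ∈ (extChartAt 𝓘(𝕜, E) x).target) :
    (mfderiv 𝓘(𝕜, E) 𝓘(𝕜, E) (extChartAt 𝓘(𝕜, E) x).symm p : E →L[𝕜] E).IsInvertible := by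
  have := isInvertible_mfderivWithin_extChartAt_symm (I := 𝓘(𝕜, E)) hp
  simp only [modelWithCornersSelf_coe, Set.range_id, mfderivWithin_univ] at this
  exact this

/-- The manifold bracket is the bracket in the chart, carried back by the chart's differential at
`x`, which is the identity for the preferred chart. -/
theorem mlieBracket_eq_lieBracket_chartField (V W : Π y : M, TangentSpace 𝓘(𝕜, E) y) (x : M) :
    VectorField.mlieBracket 𝓘(𝕜, E) V W x =
      VectorField.lieBracket 𝕜 (chartField 𝕜 x V) (chartField 𝕜 x W) (extChartAt 𝓘(𝕜, E) x x) := by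
  have h1 : ((extChartAt 𝓘(𝕜, E) x).symm ⁻¹' Set.univ ∩ Set.range 𝓘(𝕜, E)) = Set.univ := by simp
  have h2 := VectorField.mlieBracketWithin_apply (I := 𝓘(𝕜, E)) (s := Set.univ) (x₀ := x)
    (V := V) (W := W)
  rw [mpullbackWithin_eq_chartField, mpullbackWithin_eq_chartField, h1,
    VectorField.lieBracketWithin_univ] at h2
  refine h2.trans ?_
  refine (congrArg (fun L : E →L[𝕜] E => L.inverse _)
    (mfderiv_extChartAt_self (I := 𝓘(𝕜, E)) (x := x))).trans ?_
  exact congrArg (fun L : E →L[𝕜] E => L _) ContinuousLinearMap.inverse_id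

theorem differentiableAt_chartField [CompleteSpace E] {V : Π y : M, TangentSpace 𝓘(𝕜, E) y} {x : M}
    (hV : ContMDiffAt 𝓘(𝕜, E) 𝓘(𝕜, E).tangent 1 (T% V) x) :
    DifferentiableAt 𝕜 (chartField 𝕜 x V) (extChartAt 𝓘(𝕜, E) x x) := by
  have := VectorField.contMDiffWithinAt_mpullbackWithin_extChartAt_symm (s := Set.univ) (n := ω)
    (V := V) hV.contMDiffWithinAt uniqueMDiffOn_univ (Set.mem_univ x) (by simp)
  rw [contMDiffWithinAt_vectorSpace_iff_contDiffWithinAt, mpullbackWithin_eq_chartField] at this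
  refine (this.contDiffAt ?_).differentiableAt (by simp)
  simpa using extChartAt_target_mem_nhds (I := 𝓘(𝕜, E)) x

end ChartField

/-! ### Restriction of scalars from `ℂ` to `ℝ` -/

section RestrictScalars

variable {E : Type*} [NormedAddCommGroup E] [NormedSpace ℂ E]
  {F : Type*} [NormedAddCommGroup F] [NormedSpace ℂ F]
  {M : Type*} [TopologicalSpace M] [ChartedSpace E M]
  {N : Type*} [TopologicalSpace N] [ChartedSpace F N]

/-- The charts are the same over both fields, and a complex Fréchet derivative is also a real one.
-/
theorem mfderiv_real_eq_complex {f : M → N} {x : M}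
    (h : MDifferentiableAt 𝓘(ℂ, E) 𝓘(ℂ, F) f x) :
    (mfderiv 𝓘(ℝ, E) 𝓘(ℝ, F) f x : E →L[ℝ] F) =
      (mfderiv 𝓘(ℂ, E) 𝓘(ℂ, F) f x : E →L[ℂ] F).restrictScalars ℝ := by
  have h' : HasMFDerivAt 𝓘(ℝ, E) 𝓘(ℝ, F) f x
      ((mfderiv 𝓘(ℂ, E) 𝓘(ℂ, F) f x : E →L[ℂ] F).restrictScalars ℝ) :=
    ⟨h.hasMFDerivAt.1, HasFDerivWithinAt.restrictScalars ℝ h.hasMFDerivAt.2⟩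
  exact h'.mfderiv

theorem ContMDiff.real_of_complex {n : ℕ∞ω} {f : M → N}
    (h : ContMDiff 𝓘(ℂ, E) 𝓘(ℂ, F) n f) : ContMDiff 𝓘(ℝ, E) 𝓘(ℝ, F) n f := fun x =>
  ⟨(h x).1, ContDiffWithinAt.restrict_scalars ℝ (h x).2⟩

theorem ContMDiff.real_of_complex_prod {n : ℕ∞ω} {f : M × M → N}
    (h : ContMDiff (𝓘(ℂ, E).prod 𝓘(ℂ, E)) 𝓘(ℂ, F) n f) :
    ContMDiff (𝓘(ℝ, E).prod 𝓘(ℝ, E)) 𝓘(ℝ, F) n f := fun x =>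
  ⟨(h x).1, ContDiffWithinAt.restrict_scalars ℝ (h x).2⟩

/-- A complex Lie group is a real Lie group for the same charts. -/
theorem lieGroup_real_of_complex {G : Type*} [TopologicalSpace G] [ChartedSpace E G] [Group G]
    [LieGroup 𝓘(ℂ, E) ω G] : LieGroup 𝓘(ℝ, E) ω G :=
  { isManifold_real_of_complex (E := E) (M := G) with
    contMDiff_mul := (contMDiff_mul 𝓘(ℂ, E) ω).real_of_complex_prod
    contMDiff_inv := (contMDiff_inv 𝓘(ℂ, E) ω).real_of_complex }

theorem inverse_restrictScalars {L : E →L[ℂ] E} (hL : L.IsInvertible) (v : E) :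
    (L.restrictScalars ℝ).inverse v = L.inverse v := by
  obtain ⟨e, rfl⟩ := hL
  let e' : E ≃L[ℝ] E := e.restrictScalars ℝ
  have h : (e : E →L[ℂ] E).restrictScalars ℝ = (e' : E →L[ℝ] E) := rfl
  rw [h, ContinuousLinearMap.inverse_equiv, ContinuousLinearMap.inverse_equiv]
  rfl

theorem chartField_real_eventuallyEq [IsManifold 𝓘(ℂ, E) ω M] (x : M) (V : M → E) :
    chartField ℝ x V =ᶠ[nhds (extChartAt 𝓘(ℂ, E) x x)] chartField ℂ x V := by
  filter_upwards [extChartAt_target_mem_nhds (I := 𝓘(ℂ, E)) x] with p hp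
  have hd : MDifferentiableAt 𝓘(ℂ, E) 𝓘(ℂ, E) (extChartAt 𝓘(ℂ, E) x).symm p :=
    ((contMDiffOn_extChartAt_symm (I := 𝓘(ℂ, E)) (n := ω) x).contMDiffAt
      (extChartAt_target_mem_nhds' hp)).mdifferentiableAt (by simp)
  have h1 := mfderiv_real_eq_complex hd
  have h2 := inverse_restrictScalars (E := E) (isInvertible_mfderiv_chart_symm (𝕜 := ℂ) hp)
    (V ((extChartAt 𝓘(ℂ, E) x).symm p))
  refine Eq.trans ?_ h2
  exact congrArg (fun L : E →L[ℝ] E => L.inverse (V ((extChartAt 𝓘(ℂ, E) x).symm p))) h1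

/-- In a chart both brackets are given by the same formula, and for complex differentiable fields
the real derivative is the complex one. This links torsion, defined by real fields, to the complex
Lie algebra. -/
theorem mlieBracket_real_eq_complex [IsManifold 𝓘(ℂ, E) ω M] [CompleteSpace E]
    {V W : M → E} {x : M}
    (hV : ContMDiffAt 𝓘(ℂ, E) 𝓘(ℂ, E).tangent 1 (fun y => tangentMk ℂ y (V y)) x)
    (hW : ContMDiffAt 𝓘(ℂ, E) 𝓘(ℂ, E).tangent 1 (fun y => tangentMk ℂ y (W y)) x) :
    (VectorField.mlieBracket 𝓘(ℝ, E) (V : Π y : M, TangentSpace 𝓘(ℝ, E) y) W x : E) =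
      VectorField.mlieBracket 𝓘(ℂ, E) (V : Π y : M, TangentSpace 𝓘(ℂ, E) y) W x := by
  have : IsManifold 𝓘(ℝ, E) ω M := isManifold_real_of_complex
  refine (mlieBracket_eq_lieBracket_chartField V W x).trans
    (Eq.trans ?_ (mlieBracket_eq_lieBracket_chartField V W x).symm)
  have hV' := differentiableAt_chartField hV
  have hW' := differentiableAt_chartField hW
  rw [VectorField.lieBracket_eq, VectorField.lieBracket_eq]
  have e1 := chartField_real_eventuallyEq x V
  have e2 := chartField_real_eventuallyEq x W
  have e3 : extChartAt 𝓘(ℝ, E) x x = extChartAt 𝓘(ℂ, E) x x := rfl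
  simp only [e3, e1.fderiv_eq, e2.fderiv_eq, e1.eq_of_nhds, e2.eq_of_nhds,
    hV'.fderiv_restrictScalars ℝ, hW'.fderiv_restrictScalars ℝ,
    ContinuousLinearMap.coe_restrictScalars']
  rfl

end RestrictScalars

section RealLieAlgebra

variable {E : Type*} [NormedAddCommGroup E] [NormedSpace ℂ E]
  {G : Type*} [TopologicalSpace G] [ChartedSpace E G] [Group G] [LieGroup 𝓘(ℂ, E) ω G]

theorem mulLeftDeriv_real_eq_complex (a b : G) (v : E) :
    mulLeftDeriv ℝ E a b v = mulLeftDeriv ℂ E a b v :=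
  congrArg (fun L : E →L[ℝ] E => L v) (mfderiv_real_eq_complex
    ((contMDiff_mul_left (I := 𝓘(ℂ, E)) (n := ω)).contMDiffAt.mdifferentiableAt (by simp)))

theorem leftTriv_real_eq_complex (a : G) (v : E) : leftTriv ℝ E a v = leftTriv ℂ E a v :=
  mulLeftDeriv_real_eq_complex a⁻¹ a v

variable [LieGroup 𝓘(ℝ, E) ω G] [FiniteDimensional ℂ E] [FiniteDimensional ℝ E] [CompleteSpace E]

theorem lieBilin_real_eq_complex (u v : E) : lieBilin ℝ E G u v = lieBilin ℂ E G u v := by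
  have h : ∀ u : E, (invField (G := G) u : G → E) =
      mulInvariantVectorField (I := 𝓘(ℂ, E)) (G := G) u :=
    fun u => funext fun a => mulLeftDeriv_real_eq_complex a 1 u
  have hs : ∀ u : E, ContMDiffAt 𝓘(ℂ, E) 𝓘(ℂ, E).tangent 1
      (T% (mulInvariantVectorField (I := 𝓘(ℂ, E)) (G := G) u)) 1 := fun u =>
    (contMDiffAt_mulInvariantVectorField (I := 𝓘(ℂ, E)) (G := G) u).of_le (by simp)
  refine Eq.trans ?_ (mlieBracket_real_eq_complex (hs u) (hs v))
  change (VectorField.mlieBracket 𝓘(ℝ, E) (invField u) (invField v) (1 : G) : E) = _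
  exact congrArg₂ (fun V W : G → E => (VectorField.mlieBracket 𝓘(ℝ, E)
    (V : Π y : G, TangentSpace 𝓘(ℝ, E) y) W (1 : G) : E)) (h u) (h v)

end RealLieAlgebra

/-! ### Left-invariant holomorphic Riemannian metrics -/

/-- The Gram determinant of a basis of a non-degenerate plane does not vanish. -/
theorem gram_ne_zero_of_nondegenerate {K V : Type*} [Field K] [AddCommGroup V] [Module K V]
    {B : LinearMap.BilinForm K V} (hs : ∀ v w, B v w = B w v) {v w : V}
    (hli : LinearIndependent K ![v, w])
    (hn : (B.restrict (Submodule.span K {v, w})).Nondegenerate) :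
    B v v * B w w - B v w ^ 2 ≠ 0 := by
  intro h
  rw [LinearIndependent.pair_iff] at hli
  -- A vector of the plane orthogonal to both basis vectors is zero, so its coefficients vanish.
  have key : ∀ a b : K, B (a • v + b • w) v = 0 → B (a • v + b • w) w = 0 → a = 0 ∧ b = 0 := by
    intro a b h1 h2
    have hz : a • v + b • w ∈ Submodule.span K {v, w} :=
      Submodule.mem_span_pair.mpr ⟨a, b, rfl⟩
    have := hn.1 ⟨_, hz⟩ fun y => by
      obtain ⟨c, d, hy⟩ := Submodule.mem_span_pair.mp y.2
      change B (a • v + b • w) (y : V) = 0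
      rw [← hy, map_add, map_smul, map_smul, h1, h2]
      simp
    exact hli a b (congrArg Subtype.val this)
  -- If the Gram determinant vanishes, `⟨v, w⟩ v - ⟨v, v⟩ w` is orthogonal to `v` and `w`. Hence
  -- `⟨v, w⟩ = ⟨v, v⟩ = 0`, and then `v` itself is orthogonal to the plane.
  have h1 := key (B v w) (-B v v) (by simp [hs w v]; ring) (by simp; linear_combination -h)
  have h2 := key (B w w) (-B v w) (by simp [hs w v]; linear_combination h) (by simp; ring)
  have h3 := key 1 0 (by simpa using h1.2) (by simpa using h1.1)
  exact one_ne_zero h3.1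

/-! ### Uniqueness of the Levi-Civita connection -/

section Uniqueness

variable {E : Type*} [NormedAddCommGroup E] [NormedSpace ℂ E]
  {M : Type*} [TopologicalSpace M] [ChartedSpace E M] [IsManifold 𝓘(ℝ, E) ω M]

/-- Two Levi-Civita connections agree on differentiable vector fields. -/
theorem IsLeviCivita.unique {g : BilinField E M} (hs : ∀ x v w, g x v w = g x w v)
    (hn : ∀ x, (g x).Nondegenerate) {D D' : RealConnection E M} (hD : IsLeviCivita g D)
    (hD' : IsLeviCivita g D') {Y : RealField E M} {x : M} (hY : Y.DiffAt x) :
    D Y x = D' Y x := by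
  -- The difference of the connections paired with a third field: skew in the last two slots by
  -- metric compatibility, symmetric in the first two by vanishing torsion.
  let a : RealField E M → RealField E M → RealField E M → ℂ := fun X Y Z =>
    g x (show E from D.along X Y x) (Z x) - g x (show E from D'.along X Y x) (Z x)
  have skew : ∀ X Y Z : RealField E M, Y.DiffAt x → Z.DiffAt x → a X Y Z = -a X Z Y := by
    intro X Y Z hY hZ
    have h1 := (hD.metric X Y Z x hY hZ).symm.trans (hD'.metric X Y Z x hY hZ)
    change g x (D.along X Y x) (Z x) + g x (Y x) (D.along X Z x) =
      g x (D'.along X Y x) (Z x) + g x (Y x) (D'.along X Z x) at h1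
    have e1 := hs x (Y x) (D.along X Z x)
    have e2 := hs x (Y x) (D'.along X Z x)
    change g x (D.along X Y x) (Z x) - g x (D'.along X Y x) (Z x) =
      -(g x (D.along X Z x) (Y x) - g x (D'.along X Z x) (Y x))
    linear_combination h1 - e1 + e2
  have symm : ∀ X Y Z : RealField E M, X.DiffAt x → Y.DiffAt x → a X Y Z = a Y X Z := by
    intro X Y Z hX hY
    have h1 := (hD.torsionFree X Y x hX hY).trans (hD'.torsionFree X Y x hX hY).symm
    have h2 : ∀ p q r s : E, p - q = r - s →
        g x p (Z x) - g x r (Z x) = g x q (Z x) - g x s (Z x) := by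
      intro p q r s h
      have h' : p - r = q - s := by
        rw [sub_eq_sub_iff_add_eq_add] at h ⊢
        rw [h, add_comm]
      have e : ∀ p q : E, g x p (Z x) - g x q (Z x) = g x (p - q : E) (Z x) := fun p q =>
        (LinearMap.map_sub₂ (g x) p q (Z x)).symm
      rw [e, e, h']
    exact h2 _ _ _ _ h1
  refine ContinuousLinearMap.ext fun u => ?_
  have hu := FiberBundle.mdifferentiableAt_extend 𝓘(ℝ, E) E u
  have h0 : ∀ w : TangentSpace 𝓘(ℝ, E) x,
      a (FiberBundle.extend E u) Y (FiberBundle.extend E w) = 0 := by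
    intro w
    have hw := FiberBundle.mdifferentiableAt_extend 𝓘(ℝ, E) E w
    -- Alternating the two symmetries six times returns to the initial arguments with the opposite
    -- sign.
    have h1 := symm _ _ (FiberBundle.extend E w) hu hY
    have h2 := skew Y _ _ hu hw
    have h3 := symm _ _ (FiberBundle.extend E u) hY hw
    have h4 := skew (FiberBundle.extend E w) _ _ hY hu
    have h5 := symm _ _ Y hw hu
    have h6 := skew (FiberBundle.extend E u) _ _ hw hY
    clear_value a
    linear_combination (1 / 2 : ℂ) * (h1 + h2 - h3 - h4 + h5 + h6)
  have h2 : ∀ p q : E, (∀ w : E, g x p w - g x q w = 0) → p = q := by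
    intro p q h
    refine sub_eq_zero.mp ((hn x).1 (p - q : E) fun w => ?_)
    exact (LinearMap.map_sub₂ (g x) p q w).trans (h w)
  refine h2 _ _ fun w => ?_
  have e : (show E from FiberBundle.extend E (show TangentSpace 𝓘(ℝ, E) x from w) x) = w :=
    FiberBundle.extend_apply_self E _
  have e' : (show E from FiberBundle.extend E u x) = u := FiberBundle.extend_apply_self E _
  have h := h0 w
  exact (congrArg₂ (fun p q : E => g x (D Y x p) q - g x (D' Y x p) q) e' e).symm.trans h

end Uniqueness

section LieGroup

set_option linter.unusedSectionVars false

variable {E : Type*} [NormedAddCommGroup E] [NormedSpace ℂ E] [FiniteDimensional ℂ E]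
  {G : Type*} [TopologicalSpace G] [ChartedSpace E G] [Group G] [LieGroup 𝓘(ℂ, E) ω G]

/-- `g` is the left-invariant metric with value `B` at `1`. -/
def IsLeftInvariantMetric (g : BilinField E G) (B : LinearMap.BilinForm ℂ E) : Prop :=
  ∀ (a : G) (u v : E), g a u v = B (leftTriv ℂ E a u) (leftTriv ℂ E a v)

variable {g : BilinField E G} {B : LinearMap.BilinForm ℂ E}

theorem IsLeftInvariantMetric.symm (hg : IsLeftInvariantMetric g B) (hs : ∀ v w, B v w = B w v)
    (x : G) (v w : TangentSpace 𝓘(ℂ, E) x) : g x v w = g x w v :=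
  (hg x v w).trans ((hs _ _).trans (hg x w v).symm)

theorem IsLeftInvariantMetric.nondegenerate (hg : IsLeftInvariantMetric g B)
    (hn : B.Nondegenerate) (x : G) : (g x).Nondegenerate := by
  constructor
  · intro v hv
    refine leftTriv_injective (𝕜 := ℂ) (E := E) x ((hn.1 _ fun w => ?_).trans (map_zero _).symm)
    have := (hg x v (leftTrivSymm ℂ E x w)).symm.trans (hv _)
    rwa [leftTriv_leftTrivSymm] at this
  · intro v hv
    refine leftTriv_injective (𝕜 := ℂ) (E := E) x ((hn.2 _ fun w => ?_).trans (map_zero _).symm)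
    have := (hg x (leftTrivSymm ℂ E x w) v).symm.trans (hv _)
    rwa [leftTriv_leftTrivSymm] at this

/-- In the left trivialization the pairing of two holomorphic fields is a fixed bilinear form
applied to two holomorphic functions. -/
theorem IsLeftInvariantMetric.isHolomorphicRiemannianMetric (hg : IsLeftInvariantMetric g B)
    (hs : ∀ v w, B v w = B w v) (hn : B.Nondegenerate) : IsHolomorphicRiemannianMetric g where
  symm := hg.symm hs
  nondegenerate := hg.nondegenerate hn
  holomorphic U hU X Y hX hY x hx := by
    have hX' := mdifferentiableAt_leftTriv_iff.mpr
      ((hX x hx).mdifferentiableAt (hU.mem_nhds hx))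
    have hY' := mdifferentiableAt_leftTriv_iff.mpr
      ((hY x hx).mdifferentiableAt (hU.mem_nhds hx))
    have h := (HasMFDerivAt.bilinear B.toContinuousBilinearMap hX' hY').mdifferentiableAt
    refine (h.congr_of_eventuallyEq
      (Filter.Eventually.of_forall fun y => ?_)).mdifferentiableWithinAt
    exact hg y (X y) (Y y)

variable [LieGroup 𝓘(ℝ, E) ω G] [FiniteDimensional ℝ E] [CompleteSpace E]

/-- A complex bilinear form as a continuous real bilinear map. -/
def realBilin (B : LinearMap.BilinForm ℂ E) : E →L[ℝ] E →L[ℝ] ℂ :=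
  (LinearMap.mk₂ ℝ (fun u v => B u v) (fun u u' v => LinearMap.map_add₂ B u u' v)
    (fun c u v => by
      rw [← Complex.coe_smul c u, LinearMap.map_smul₂, Complex.coe_smul])
    (fun u v v' => map_add (B u) v v')
    (fun c u v => by
      rw [← Complex.coe_smul c v, map_smul, Complex.coe_smul])).toContinuousBilinearMap

theorem realBilin_apply (u v : E) : realBilin B u v = B u v := rfl

theorem IsLeftInvariantMetric.apply_real (hg : IsLeftInvariantMetric g B) (a : G) (u v : E) :
    g a u v = realBilin B (leftTriv ℝ E a u) (leftTriv ℝ E a v) := by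
  rw [hg, realBilin_apply, leftTriv_real_eq_complex, leftTriv_real_eq_complex]

/-- Skewness of `ad u` for `B` cancels the two `½ [X, ·]` terms, and what remains is the product
rule for `B` in the left trivialization. -/
theorem IsLeftInvariantMetric.isLeviCivita (hg : IsLeftInvariantMetric g B)
    (hB : ∀ u v w, B (lieBilin ℂ E G u v) w = -B v (lieBilin ℂ E G u w)) :
    IsLeviCivita g (symmConnection (E := E) (G := G)) where
  torsionFree X Y x hX hY := symmConnection_torsionFree hX hY
  metric X Y Z x hY hZ := by
    have hB' : ∀ u v w, realBilin B (lieBilin ℝ E G u v) w =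
        -realBilin B v (lieBilin ℝ E G u w) := fun u v w => by
      simp only [realBilin_apply, lieBilin_real_eq_complex, hB]
    have hp : g.pair Y Z = fun y => realBilin B (trivField Y y) (trivField Z y) :=
      funext fun y => hg.apply_real y (Y y) (Z y)
    have h1 := chartDeriv_bilinear (realBilin B) (mdifferentiableAt_trivField_iff.mpr hY)
      (mdifferentiableAt_trivField_iff.mpr hZ) (X x)
    have h2 := hg.apply_real x (symmConnection Y x (X x)) (Z x)
    have h3 := hg.apply_real x (Y x) (symmConnection Z x (X x))
    rw [leftTriv_symmConnection] at h2 h3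
    rw [hp]
    refine h1.trans (Eq.trans ?_ (congrArg₂ (· + ·) h2 h3).symm)
    simp only [map_add, map_smul, FunLike.coe_add, FunLike.coe_smul, Pi.add_apply, Pi.smul_apply]
    have h4 := hB' (leftTriv ℝ E x (X x)) (trivField Y x) (trivField Z x)
    change _ = realBilin B _ (trivField Z x) + (1 / 2 : ℝ) • realBilin B _ (trivField Z x) +
      (realBilin B (trivField Y x) _ + (1 / 2 : ℝ) • realBilin B (trivField Y x) _)
    rw [h4]
    module

/-- Every Levi-Civita connection of a bi-invariant metric is the symmetric connection. -/
theorem IsLeftInvariantMetric.eq_symmConnection (hg : IsLeftInvariantMetric g B)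
    (hs : ∀ v w, B v w = B w v) (hn : B.Nondegenerate)
    (hB : ∀ u v w, B (lieBilin ℂ E G u v) w = -B v (lieBilin ℂ E G u w))
    {D : RealConnection E G} (hD : IsLeviCivita g D) (Y : RealField E G) (x : G)
    (hY : Y.DiffAt x) : D Y x = symmConnection Y x :=
  IsLeviCivita.unique (hg.symm hs) (hg.nondegenerate hn) hD (hg.isLeviCivita hB) hY

theorem IsLeftInvariantMetric.along_of_isLeftInvariant (hg : IsLeftInvariantMetric g B)
    (hs : ∀ v w, B v w = B w v) (hn : B.Nondegenerate)
    (hB : ∀ u v w, B (lieBilin ℂ E G u v) w = -B v (lieBilin ℂ E G u w))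
    {D : RealConnection E G} (hD : IsLeviCivita g D) {X Y : RealField E G}
    (hX : IsLeftInvariant X) (hY : IsLeftInvariant Y) (a : G) :
    D.along X Y a = (1 / 2 : ℝ) • VectorField.mlieBracket 𝓘(ℝ, E) X Y a := by
  -- A left-invariant field is the translate of its value at `1`.
  have key : ∀ X : RealField E G, IsLeftInvariant X → ∃ v : E, X = invField v := by
    intro X hX
    refine ⟨X 1, funext fun a => ?_⟩
    have h := hX a 1
    rw [mul_one] at h
    exact h.symm
  obtain ⟨v, rfl⟩ := key X hX
  obtain ⟨w, rfl⟩ := key Y hY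
  unfold RealConnection.along
  rw [hg.eq_symmConnection hs hn hB hD _ a (mdifferentiableAt_invField _ a)]
  exact symmConnection_invField _ _ a

theorem IsLeftInvariantMetric.leftTriv_curvatureTensor (hg : IsLeftInvariantMetric g B)
    (hs : ∀ v w, B v w = B w v) (hn : B.Nondegenerate)
    (hB : ∀ u v w, B (lieBilin ℂ E G u v) w = -B v (lieBilin ℂ E G u w))
    {D : RealConnection E G} (hD : IsLeviCivita g D) (x : G) (u v w : TangentSpace 𝓘(ℝ, E) x) :
    leftTriv ℝ E x (curvatureTensor D x u v w) =
      -((1 / 4 : ℝ) • lieBilin ℝ E G (lieBilin ℝ E G (leftTriv ℝ E x u) (leftTriv ℝ E x v))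
        (leftTriv ℝ E x w)) := by
  refine Eq.trans ?_ (leftTriv_curvature (hg.eq_symmConnection hs hn hB hD) u v w)
  unfold curvatureTensor curvatureField RealConnection.along
  rw [mlieBracket_extend, map_zero, sub_zero, FiberBundle.extend_apply_self,
    FiberBundle.extend_apply_self]

/-- The sectional curvature is `-1` if `‖[v, w]‖² = -4 ‖v‖² ‖w‖² + 4 ⟨v, w⟩²`. -/
theorem IsLeftInvariantMetric.hasConstantSectionalCurvature (hg : IsLeftInvariantMetric g B)
    (hs : ∀ v w, B v w = B w v) (hn : B.Nondegenerate)
    (hB : ∀ u v w, B (lieBilin ℂ E G u v) w = -B v (lieBilin ℂ E G u w))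
    (hG : ∀ v w, B (lieBilin ℂ E G v w) (lieBilin ℂ E G v w) =
      -4 * (B v v * B w w) + 4 * B v w ^ 2) :
    HasConstantSectionalCurvature g (-1) := by
  refine ⟨⟨_, hg.isLeviCivita hB⟩, fun D hD x v w hvw => ?_⟩
  have h0 := gram_ne_zero_of_nondegenerate (hg.symm hs x) hvw.1 hvw.2
  -- Skewness turns `-¼ ⟨[[a, b], b], a⟩` into `¼ ‖[a, b]‖²`, to which `hG` applies.
  have main : ∀ a b : E, realBilin B (-((1 / 4 : ℝ) • lieBilin ℝ E G (lieBilin ℝ E G a b) b)) a =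
      -1 * (B a a * B b b - B a b ^ 2) := by
    intro a b
    have h1 := hB b (lieBilin ℂ E G a b) a
    have h2 := hG a b
    rw [lieBilin_swap b (lieBilin ℂ E G a b), lieBilin_swap b a, LinearMap.map_neg₂,
      map_neg] at h1
    simp only [map_neg, map_smul, FunLike.coe_neg, FunLike.coe_smul, Pi.neg_apply, Pi.smul_apply,
      realBilin_apply, lieBilin_real_eq_complex, Complex.real_smul]
    push_cast
    linear_combination (1 / 4 : ℂ) * h1 + (1 / 4 : ℂ) * h2
  unfold sectionalCurvature
  rw [div_eq_iff h0]
  have h1 := hg.apply_real x (curvatureTensor D x v w w) v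
  have h2 := hg.leftTriv_curvatureTensor hs hn hB hD x v w w
  refine h1.trans ((congrArg (fun z : E => realBilin B z (leftTriv ℝ E x v)) h2).trans ?_)
  refine (main (leftTriv ℝ E x v) (leftTriv ℝ E x w)).trans ?_
  have e : ∀ u v : E, g x u v = B (leftTriv ℝ E x u) (leftTriv ℝ E x v) := hg.apply_real x
  exact (congrArg (fun z : ℂ => -1 * z) (congrArg₂ (fun p q : ℂ => p - q)
    (congrArg₂ (fun p q : ℂ => p * q) (e v v) (e w w))
    (congrArg (fun z : ℂ => z ^ 2) (e v w)))).symm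

end LieGroup

/-! ### The Lie algebra of a Lie group in a chart -/

section ChartBracket

variable {E : Type*} [NormedAddCommGroup E] [NormedSpace ℂ E]
  {G : Type*} [TopologicalSpace G] [ChartedSpace E G]

theorem hasMFDerivAt_extChartAt_symm [IsManifold 𝓘(ℂ, E) ω G] (x : G) :
    HasMFDerivAt 𝓘(ℂ, E) 𝓘(ℂ, E) (extChartAt 𝓘(ℂ, E) x).symm (extChartAt 𝓘(ℂ, E) x x)
      (ContinuousLinearMap.id ℂ E) := by
  have h := (mdifferentiableWithinAt_extChartAt_symm (I := 𝓘(ℂ, E))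
    (mem_extChartAt_target (I := 𝓘(ℂ, E)) x)).hasMFDerivWithinAt
  have h' := mfderivWithin_range_extChartAt_symm (I := 𝓘(ℂ, E)) (x := x)
  simp only [modelWithCornersSelf_coe, Set.range_id, hasMFDerivWithinAt_univ] at h h'
  rw [h'] at h
  exact h

variable [Group G] [LieGroup 𝓘(ℂ, E) ω G]

/-- A left-invariant vector field in the chart at `1`. -/
theorem chartField_leftTrivSymm {v p w : E}
    (hp : p ∈ (extChartAt 𝓘(ℂ, E) (1 : G)).target)
    (h : fderiv ℂ (fun y => extChartAt 𝓘(ℂ, E) (1 : G) ((extChartAt 𝓘(ℂ, E) (1 : G)).symm p *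
      (extChartAt 𝓘(ℂ, E) (1 : G)).symm y)) (extChartAt 𝓘(ℂ, E) (1 : G) 1) v = w) :
    chartField ℂ (1 : G) (leftTrivSymm ℂ E · v) p = w := by
  set e := extChartAt 𝓘(ℂ, E) (1 : G) with he
  set a := e.symm p with ha
  have hinv := isInvertible_mfderiv_chart_symm (𝕜 := ℂ) hp
  refine (hinv.inverse_apply_eq).mpr ?_
  have h1 : e.symm (e 1) = 1 := e.left_inv (mem_extChartAt_source 1)
  have hea : e a = p := e.right_inv hp
  have has : a ∈ e.source := e.map_target hp
  have hL : HasMFDerivAt 𝓘(ℂ, E) 𝓘(ℂ, E) (fun y : G => a * y) (e.symm (e 1))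
      (leftTrivSymm ℂ E a) := by
    rw [h1]
    exact ((contMDiff_mul_left (I := 𝓘(ℂ, E)) (n := ω)).contMDiffAt.mdifferentiableAt
      (by simp)).hasMFDerivAt
  have hg : HasMFDerivAt 𝓘(ℂ, E) 𝓘(ℂ, E) (fun y => a * e.symm y) (e 1) (leftTrivSymm ℂ E a) :=
    hL.comp (e 1) (hasMFDerivAt_extChartAt_symm (1 : G))
  have hd : HasMFDerivAt 𝓘(ℂ, E) 𝓘(ℂ, E) e a
      (mfderiv 𝓘(ℂ, E) 𝓘(ℂ, E) e a) :=
    (mdifferentiableAt_extChartAt (by rwa [← extChartAt_source 𝓘(ℂ, E)])).hasMFDerivAt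
  have hd' : HasMFDerivAt 𝓘(ℂ, E) 𝓘(ℂ, E) e (a * e.symm (e 1))
      (mfderiv 𝓘(ℂ, E) 𝓘(ℂ, E) e a : E →L[ℂ] E) := by
    rw [h1, mul_one]
    exact hd
  have hc : HasMFDerivAt 𝓘(ℂ, E) 𝓘(ℂ, E) (fun y => e (a * e.symm y)) (e 1)
      ((mfderiv 𝓘(ℂ, E) 𝓘(ℂ, E) e a : E →L[ℂ] E).comp (leftTrivSymm ℂ E a)) := hd'.comp (e 1) hg
  let T : E →L[ℂ] E := mfderiv 𝓘(ℂ, E) 𝓘(ℂ, E) e a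
  have hf : HasFDerivAt (fun y : E => (e (a * e.symm y) : E)) (T.comp (leftTrivSymm ℂ E a)) (e 1) :=
    hasMFDerivAt_iff_hasFDerivAt.mp hc
  have hw : w = (mfderiv 𝓘(ℂ, E) 𝓘(ℂ, E) e a : E →L[ℂ] E) (leftTrivSymm ℂ E a v) :=
    h.symm.trans (congrArg (fun L : E →L[ℂ] E => L v) (HasFDerivAt.fderiv hf))
  have hs : HasMFDerivAt 𝓘(ℂ, E) 𝓘(ℂ, E) e.symm (e a)
      (mfderiv 𝓘(ℂ, E) 𝓘(ℂ, E) e.symm p : E →L[ℂ] E) := by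
    rw [hea]
    have := (mdifferentiableWithinAt_extChartAt_symm (I := 𝓘(ℂ, E)) hp)
    simp only [modelWithCornersSelf_coe, Set.range_id, mdifferentiableWithinAt_univ] at this
    exact this.hasMFDerivAt
  -- Since `e.symm ∘ e` is the identity near `a`, the differential of `e.symm` undoes that of `e`.
  -- This is what inverting the chart differential in `chartField` requires.
  have hid : HasMFDerivAt 𝓘(ℂ, E) 𝓘(ℂ, E) (id : G → G) a
      ((mfderiv 𝓘(ℂ, E) 𝓘(ℂ, E) e.symm p : E →L[ℂ] E).comp
        (mfderiv 𝓘(ℂ, E) 𝓘(ℂ, E) e a : E →L[ℂ] E)) := by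
    refine (hs.comp a hd).congr_of_eventuallyEq ?_
    filter_upwards [(isOpen_extChartAt_source (I := 𝓘(ℂ, E)) (1 : G)).mem_nhds has] with y hy
    exact (e.left_inv hy).symm
  have hfin := hasMFDerivAt_unique hid (hasMFDerivAt_id a)
  rw [hw]
  exact (congrArg (fun L : E →L[ℂ] E => L (leftTrivSymm ℂ E a v)) hfin).symm

/-- The bracket from the second-order part of the multiplication in the chart at `1`. -/
theorem lieBilin_eq_of_chart [CompleteSpace E] [FiniteDimensional ℂ E]
    {W : E → E →L[ℂ] E} {A : E → E →L[ℂ] E}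
    (hW : ∀ᶠ p in nhds (extChartAt 𝓘(ℂ, E) (1 : G) 1),
      HasFDerivAt (fun y => extChartAt 𝓘(ℂ, E) (1 : G) ((extChartAt 𝓘(ℂ, E) (1 : G)).symm p *
      (extChartAt 𝓘(ℂ, E) (1 : G)).symm y)) (W p) (extChartAt 𝓘(ℂ, E) (1 : G) 1))
    (h1 : ∀ v, W (extChartAt 𝓘(ℂ, E) (1 : G) 1) v = v)
    (hA : ∀ v, HasFDerivAt (fun p => W p v) (A v) (extChartAt 𝓘(ℂ, E) (1 : G) 1))
    (v w : E) : lieBilin ℂ E G v w = A w v - A v w := by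
  have key : ∀ v, chartField ℂ (1 : G) (leftTrivSymm ℂ E · v)
      =ᶠ[nhds (extChartAt 𝓘(ℂ, E) (1 : G) 1)] fun p => W p v := fun v => by
    filter_upwards [hW, extChartAt_target_mem_nhds (I := 𝓘(ℂ, E)) (1 : G)] with p hp hp'
    exact chartField_leftTrivSymm hp' (by rw [hp.fderiv])
  have h := mlieBracket_eq_lieBracket_chartField (𝕜 := ℂ)
    (mulInvariantVectorField (I := 𝓘(ℂ, E)) (G := G) v)
    (mulInvariantVectorField (I := 𝓘(ℂ, E)) (G := G) w) 1
  refine Eq.trans h ?_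
  change VectorField.lieBracket ℂ (chartField ℂ (1 : G) (leftTrivSymm ℂ E · v))
    (chartField ℂ (1 : G) (leftTrivSymm ℂ E · w)) (extChartAt 𝓘(ℂ, E) (1 : G) 1) = _
  rw [(key v).lieBracket_vectorField_eq (key w), VectorField.lieBracket_eq]
  simp only [(hA v).fderiv, (hA w).fderiv, h1]

end ChartBracket

/-! ### The Lie algebras of `SL(2,ℂ)` and `PSL(2,ℂ)` -/

open TracelessMat

namespace TracelessMat

/-- The trace-zero part of the matrix product. -/
def mulBilin : TracelessMat →L[ℂ] TracelessMat →L[ℂ] TracelessMat :=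
  (((LinearMap.mul ℂ (Matrix (Fin 2) (Fin 2) ℂ)).compl₁₂ toMat toMat).compr₂
    proj).toContinuousBilinearMap

theorem mulBilin_apply (u v : TracelessMat) : mulBilin u v = proj (toMat u * toMat v) := rfl

theorem root_zero : root 0 = 1 := by
  simp [root]

/-- For `2 × 2` matrices `det (-N) = det N`, so `root` is even and its derivative at `0` equals its
own negative. -/
theorem hasFDerivAt_root_zero : HasFDerivAt root (0 : TracelessMat →L[ℂ] ℂ) 0 := by
  have h : DifferentiableAt ℂ root 0 :=
    (contDiffAt_root (N := 0) (by simp)).differentiableAt (by simp)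
  have h1 : HasFDerivAt root (fderiv ℂ root 0) (-0 : TracelessMat) := by
    rw [neg_zero]
    exact h.hasFDerivAt
  have h2 := h1.comp (0 : TracelessMat) (hasFDerivAt_id (𝕜 := ℂ) (0 : TracelessMat)).neg
  have h3 : root ∘ Neg.neg = root := by
    ext N
    simp [root, Matrix.det_fin_two]
  rw [h3] at h2
  have h4 := h.hasFDerivAt.unique h2
  have h5 : fderiv ℂ root 0 = 0 := by
    ext v
    have := congrArg (fun L : TracelessMat →L[ℂ] ℂ => L v) h4
    simp at this
    simpa using self_eq_neg.mp this
  rw [← h5]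
  exact h.hasFDerivAt

theorem proj_one : proj 1 = 0 := by
  simpa using proj_toMat_add 0 1

/-- Group multiplication in the chart. Because `root` is stationary at `0`, the bilinear term
`mulBilin p y` alone determines the bracket. -/
theorem proj_mul_chart (p y : TracelessMat) :
    proj ((toMat p + root p • 1) * (toMat y + root y • 1)) =
      mulBilin p y + root p • y + root y • p := by
  have h : ∀ N, proj (toMat N) = N := fun N => by simpa using proj_toMat_add N 0
  simp only [add_mul, mul_add, map_add, mulBilin_apply, smul_mul_assoc, mul_smul_comm, one_mul,
    mul_one, map_smul, proj_one, smul_zero, add_zero, h]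

/-- A group with the multiplication of trace-zero matrices near the identity. -/
theorem lieBilin_eq {G : Type*} [TopologicalSpace G] [ChartedSpace TracelessMat G] [Group G]
    [LieGroup 𝓘(ℂ, TracelessMat) ω G] (h0 : extChartAt 𝓘(ℂ, TracelessMat) (1 : G) 1 = 0)
    (h : ∀ᶠ q : TracelessMat × TracelessMat in nhds (0, 0),
      extChartAt 𝓘(ℂ, TracelessMat) (1 : G) ((extChartAt 𝓘(ℂ, TracelessMat) (1 : G)).symm q.1 *
        (extChartAt 𝓘(ℂ, TracelessMat) (1 : G)).symm q.2) =
      proj ((toMat q.1 + root q.1 • 1) * (toMat q.2 + root q.2 • 1)))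
    (v w : TracelessMat) :
    lieBilin ℂ TracelessMat G v w = proj (toMat v * toMat w - toMat w * toMat v) := by
  -- `W p` is the derivative of the product in its second factor at `0`, where the term `root y • p`
  -- contributes nothing. Differentiating `W p v` in `p` at `0` leaves `p ↦ mulBilin p v`.
  have key := lieBilin_eq_of_chart (G := G)
    (W := fun p => mulBilin p + root p • ContinuousLinearMap.id ℂ TracelessMat)
    (A := fun v => mulBilin.flip v) ?_ ?_ ?_ v w
  · rw [key, map_sub]
    rfl
  · rw [h0]
    rw [nhds_prod_eq] at h
    filter_upwards [h.curry] with p hp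
    refine HasFDerivAt.congr_of_eventuallyEq ?_ (hp.mono fun y hy => hy.trans (proj_mul_chart p y))
    have h1 := (((mulBilin p).hasFDerivAt (x := 0)).add
      ((root p • ContinuousLinearMap.id ℂ TracelessMat).hasFDerivAt (x := 0))).add
      (hasFDerivAt_root_zero.smul_const p)
    refine h1.congr_fderiv ?_
    ext u
    simp
  · intro v
    rw [h0]
    simp [root_zero]
  · intro v
    rw [h0]
    have h1 := ((mulBilin.flip v).hasFDerivAt (x := 0)).add (hasFDerivAt_root_zero.smul_const v)
    refine h1.congr_fderiv ?_
    ext u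
    simp

end TracelessMat

theorem SL2C.lieBilin_eq (v w : TracelessMat) :
    lieBilin ℂ TracelessMat SL2C v w = proj (toMat v * toMat w - toMat w * toMat v) := by
  refine TracelessMat.lieBilin_eq ?_ (Filter.Eventually.of_forall fun q => ?_) v w
  · change proj (((1 : SL2C)⁻¹ * 1 : SL2C) : Matrix (Fin 2) (Fin 2) ℂ) = 0
    simpa using proj_one
  · change proj (((1 : SL2C)⁻¹ * ((translatedChart SL2C.chartOne 1).symm q.1 *
      (translatedChart SL2C.chartOne 1).symm q.2) : SL2C) : Matrix (Fin 2) (Fin 2) ℂ) = _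
    rw [translatedChart_symm_apply, translatedChart_symm_apply, inv_one, one_mul, one_mul, one_mul]
    rfl

/-- The chart formula applies to representatives whose trace has positive real part. The product of
two representatives near `I` has trace near `2`, so the formula holds close to the origin. -/
theorem PSL2C.lieBilin_eq (v w : TracelessMat) :
    lieBilin ℂ TracelessMat PSL2C v w = proj (toMat v * toMat w - toMat w * toMat v) := by
  refine TracelessMat.lieBilin_eq ?_ ?_ v w
  · change PSL2C.chartOne ((1 : PSL2C)⁻¹ * 1) = 0
    rw [inv_one, one_mul, ← map_one slToPSL, PSL2C.chartOne_apply SL2C.one_mem_chartOne_source]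
    change proj ((1 : SL2C) : Matrix (Fin 2) (Fin 2) ℂ) = 0
    simpa using proj_one
  · have hc : ContinuousAt (fun q : TracelessMat × TracelessMat =>
        ((toMat q.1 + root q.1 • 1) * (toMat q.2 + root q.2 • 1)).trace.re) (0, 0) := by
      have hr : ContinuousAt root 0 := (contDiffAt_root (N := 0) (by simp)).continuousAt
      let M : TracelessMat → Matrix (Fin 2) (Fin 2) ℂ := fun p => toMat p + root p • 1
      have hm : ContinuousAt M 0 :=
        continuous_toMat.continuousAt.add (hr.smul continuousAt_const)
      have h1 : ContinuousAt (fun q : TracelessMat × TracelessMat =>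
          toMat q.1 + root q.1 • (1 : Matrix (Fin 2) (Fin 2) ℂ)) (0, 0) :=
        ContinuousAt.comp (x := ((0, 0) : TracelessMat × TracelessMat)) (g := M) hm continuousAt_fst
      have h2 : ContinuousAt (fun q : TracelessMat × TracelessMat =>
          toMat q.2 + root q.2 • (1 : Matrix (Fin 2) (Fin 2) ℂ)) (0, 0) :=
        ContinuousAt.comp (x := ((0, 0) : TracelessMat × TracelessMat)) (g := M) hm continuousAt_snd
      have ht : Continuous fun A : Matrix (Fin 2) (Fin 2) ℂ => A.trace.re :=
        Complex.continuous_re.comp continuous_id.matrix_trace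
      exact ContinuousAt.comp (x := ((0, 0) : TracelessMat × TracelessMat))
        (g := fun A : Matrix (Fin 2) (Fin 2) ℂ => A.trace.re) ht.continuousAt (h1.mul h2)
    have hpos : (0 : ℝ) < ((toMat (0 : TracelessMat) + root 0 • 1) *
        (toMat (0 : TracelessMat) + root 0 • 1)).trace.re := by
      simp [root_zero]
    filter_upwards [hc.eventually (lt_mem_nhds hpos)] with q hq
    change PSL2C.chartOne ((1 : PSL2C)⁻¹ * ((translatedChart PSL2C.chartOne 1).symm q.1 *
      (translatedChart PSL2C.chartOne 1).symm q.2)) = _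
    rw [translatedChart_symm_apply, translatedChart_symm_apply, inv_one, one_mul, one_mul, one_mul,
      PSL2C.chartOne_symm_apply, PSL2C.chartOne_symm_apply, ← map_mul, PSL2C.chartOne_apply hq]
    rfl

/-! ### The metrics of `SL(2,ℂ)` and `PSL(2,ℂ)` -/

namespace TracelessMat

theorem toMat_one_one (N : TracelessMat) : toMat N 1 1 = -toMat N 0 0 := by
  have h := trace_toMat N
  rw [Matrix.trace_fin_two] at h
  linear_combination h

/-- A trace-zero matrix from the entries `00`, `01`, `10`. -/
def coordEquiv : TracelessMat ≃ₗ[ℂ] (Fin 3 → ℂ) where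
  toFun N := ![toMat N 0 0, toMat N 0 1, toMat N 1 0]
  invFun x := proj !![x 0, x 1; x 2, -x 0]
  map_add' u v := by ext i; fin_cases i <;> simp
  map_smul' c u := by ext i; fin_cases i <;> simp
  left_inv N := by
    apply toMat_injective
    ext i j
    fin_cases i <;> fin_cases j <;> simp [toMat_proj, Matrix.trace_fin_two, toMat_one_one]
  right_inv x := by
    ext i
    fin_cases i <;> simp [toMat_proj, Matrix.trace_fin_two]

theorem coordEquiv_apply (N : TracelessMat) :
    coordEquiv N = ![toMat N 0 0, toMat N 0 1, toMat N 1 0] := rfl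

theorem toMat_coordEquiv_symm (x : Fin 3 → ℂ) :
    toMat (coordEquiv.symm x) = !![x 0, x 1; x 2, -x 0] := by
  change toMat (proj !![x 0, x 1; x 2, -x 0]) = _
  simp [toMat_proj, Matrix.trace_fin_two]

theorem trace_eq_coord (f : TracelessMat →ₗ[ℂ] TracelessMat) :
    LinearMap.trace ℂ TracelessMat f = ∑ i, coordEquiv (f (coordEquiv.symm (Pi.single i 1))) i := by
  rw [LinearMap.trace_eq_matrix_trace ℂ (Module.Basis.ofEquivFun coordEquiv), Matrix.trace]
  refine Finset.sum_congr rfl fun i _ => ?_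
  rw [Matrix.diag_apply, LinearMap.toMatrix_apply]
  simp [Module.Basis.ofEquivFun_repr_apply]

/-- Half the trace form of `2 × 2` matrices. -/
def halfTrace : LinearMap.BilinForm ℂ TracelessMat :=
  LinearMap.mk₂ ℂ (fun u v => (1 / 2 : ℂ) * (toMat u * toMat v).trace)
    (fun u u' v => by simp [add_mul, mul_add])
    (fun c u v => by simp; ring)
    (fun u v v' => by simp [mul_add])
    (fun c u v => by simp; ring)

theorem halfTrace_apply (u v : TracelessMat) : halfTrace u v = toMat u 0 0 * toMat v 0 0 +
    (1 / 2 : ℂ) * (toMat u 0 1 * toMat v 1 0 + toMat u 1 0 * toMat v 0 1) := by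
  change (1 / 2 : ℂ) * (toMat u * toMat v).trace = _
  simp only [Matrix.trace_fin_two, Matrix.mul_apply, Fin.sum_univ_two, toMat_one_one]
  ring

theorem halfTrace_symm (u v : TracelessMat) : halfTrace u v = halfTrace v u := by
  simp only [halfTrace_apply]
  ring

/-- Pairing with the three coordinate matrices reads off the entries up to nonzero factors. -/
theorem halfTrace_nondegenerate : halfTrace.Nondegenerate := by
  have h : ∀ u, (∀ v, halfTrace u v = 0) → u = 0 := by
    intro u hu
    apply coordEquiv.injective
    have h0 := hu (coordEquiv.symm ![1, 0, 0])
    have h1 := hu (coordEquiv.symm ![0, 1, 0])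
    have h2 := hu (coordEquiv.symm ![0, 0, 1])
    simp [halfTrace_apply, coordEquiv, toMat_proj, Matrix.trace_fin_two] at h0 h1 h2
    ext i
    fin_cases i <;> simp [coordEquiv, h0, h1, h2]
  exact ⟨h, fun v hv => h v fun u => (halfTrace_symm v u).trans (hv u)⟩

/-- The commutator of trace-zero matrices. -/
def commutator (u v : TracelessMat) : TracelessMat := proj (toMat u * toMat v - toMat v * toMat u)

/-- A commutator already has trace zero, so `proj` leaves it unchanged. -/
theorem toMat_commutator (u v : TracelessMat) :
    toMat (commutator u v) = toMat u * toMat v - toMat v * toMat u := by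
  rw [commutator, toMat_proj, Matrix.trace_sub, Matrix.trace_mul_comm]
  simp

/-- This is the invariance of the trace form, a consequence of cyclicity of the trace; here it is
checked in entries. -/
theorem halfTrace_commutator (u v w : TracelessMat) :
    halfTrace (commutator u v) w = -halfTrace v (commutator u w) := by
  simp only [halfTrace_apply, toMat_commutator, Matrix.sub_apply, Matrix.mul_apply,
    Fin.sum_univ_two, toMat_one_one]
  ring

/-- In Pauli coordinates `halfTrace` is the dot product of `ℂ³` and the commutator is `2i` times the
cross product, so this is Lagrange's identity; the factor `-4` is `(2i)²`. -/
theorem halfTrace_commutator_self (u v : TracelessMat) :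
    halfTrace (commutator u v) (commutator u v) =
      -4 * (halfTrace u u * halfTrace v v) + 4 * halfTrace u v ^ 2 := by
  simp only [halfTrace_apply, toMat_commutator, Matrix.sub_apply, Matrix.mul_apply,
    Fin.sum_univ_two, toMat_one_one]
  ring

/-- The Killing form of `𝔰𝔩(2,ℂ)` is `4 tr(uv)`, which explains the factor `8` and the normalization
`1/8` of the metric. The trace is summed over the three entry coordinates. -/
theorem trace_commutator_commutator (u v : TracelessMat) {f : TracelessMat →ₗ[ℂ] TracelessMat}
    (hf : ∀ w, f w = commutator u (commutator v w)) :
    LinearMap.trace ℂ TracelessMat f = 8 * halfTrace u v := by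
  rw [trace_eq_coord]
  simp only [hf, Fin.sum_univ_three]
  simp only [coordEquiv_apply, toMat_commutator, Matrix.sub_apply, Matrix.mul_apply,
    Fin.sum_univ_two, toMat_one_one, halfTrace_apply, toMat_coordEquiv_symm]
  simp
  ring

end TracelessMat

instance : LieGroup 𝓘(ℝ, TracelessMat) ω PSL2C := lieGroup_real_of_complex

instance : LieGroup 𝓘(ℝ, TracelessMat) ω SL2C := lieGroup_real_of_complex

instance : FiniteDimensional ℝ TracelessMat := FiniteDimensional.complexToReal TracelessMat

theorem PSL2C.killingForm_eq (u v : TracelessMat) :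
    killingForm ℂ PSL2C.lieAlgebra u v = 8 * halfTrace u v := by
  refine Eq.trans ?_ (trace_commutator_commutator u v
    (f := (lieLinear ℂ TracelessMat PSL2C u).comp (lieLinear ℂ TracelessMat PSL2C v))
    fun w => ?_)
  · exact LieModule.traceForm_apply_apply ℂ PSL2C.lieAlgebra PSL2C.lieAlgebra u v
  · change lieBilin ℂ TracelessMat PSL2C u (lieBilin ℂ TracelessMat PSL2C v w) = _
    rw [PSL2C.lieBilin_eq, PSL2C.lieBilin_eq]
    rfl

theorem isLeftInvariantMetric_pslMetric : IsLeftInvariantMetric pslMetric halfTrace := by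
  intro a u v
  change (1 / 8 : ℂ) * killingForm ℂ PSL2C.lieAlgebra (leftTriv ℂ TracelessMat a u)
    (leftTriv ℂ TracelessMat a v) = _
  rw [PSL2C.killingForm_eq]
  ring

/-- In the preferred charts, the differential of the projection is the identity. -/
theorem hasMFDerivAt_slToPSL (A : SL2C) :
    HasMFDerivAt 𝓘(ℂ, TracelessMat) 𝓘(ℂ, TracelessMat) slToPSL A
      (ContinuousLinearMap.id ℂ TracelessMat) := by
  refine ⟨PSL2C.continuous_slToPSL.continuousAt, ?_⟩
  have h : writtenInExtChartAt 𝓘(ℂ, TracelessMat) 𝓘(ℂ, TracelessMat) A slToPSL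
      =ᶠ[nhds (extChartAt 𝓘(ℂ, TracelessMat) A A)] id := by
    filter_upwards [extChartAt_target_mem_nhds (I := 𝓘(ℂ, TracelessMat)) A] with N hN
    change PSL2C.chartOne ((slToPSL A)⁻¹ * slToPSL ((translatedChart SL2C.chartOne A).symm N)) = N
    have hN' : N ∈ SL2C.chartOne.target := by
      rw [← translatedChart_target SL2C.chartOne A]
      simp only [mfld_simps] at hN
      exact hN
    rw [translatedChart_symm_apply, ← map_inv, ← map_mul, inv_mul_cancel_left,
      PSL2C.chartOne_apply (SL2C.chartOne.map_target hN'), SL2C.chartOne.right_inv hN']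
  exact ((hasFDerivAt_id _).congr_of_eventuallyEq h).hasFDerivWithinAt

/-- The projection is a homomorphism, so it intertwines left translations, and in the preferred
charts its differential is the identity. -/
theorem leftTriv_slToPSL (A : SL2C) :
    leftTriv ℂ TracelessMat (slToPSL A) = leftTriv ℂ TracelessMat A := by
  have hd : ∀ {G : Type} [TopologicalSpace G] [ChartedSpace TracelessMat G] [Group G]
      [LieGroup 𝓘(ℂ, TracelessMat) ω G] (a b : G), HasMFDerivAt 𝓘(ℂ, TracelessMat)
      𝓘(ℂ, TracelessMat) (fun y : G => a * y) b (mulLeftDeriv ℂ TracelessMat a b) := fun a b =>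
    ((contMDiff_mul_left (I := 𝓘(ℂ, TracelessMat)) (n := ω)).contMDiffAt.mdifferentiableAt
      (by simp)).hasMFDerivAt
  have h1 := (hd (slToPSL A)⁻¹ (slToPSL A)).comp A (hasMFDerivAt_slToPSL A)
  have h2 := (hasMFDerivAt_slToPSL (A⁻¹ * A)).comp A (hd A⁻¹ A)
  have h3 : (fun y => (slToPSL A)⁻¹ * y) ∘ slToPSL = slToPSL ∘ (fun y => A⁻¹ * y) := by
    ext y
    simp
  rw [h3] at h1
  have h4 := hasMFDerivAt_unique h1 h2
  exact h4

theorem isLeftInvariantMetric_slMetric : IsLeftInvariantMetric slMetric halfTrace := by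
  intro A u v
  have h : (mfderiv 𝓘(ℂ, TracelessMat) 𝓘(ℂ, TracelessMat) slToPSL A :
    TracelessMat →L[ℂ] TracelessMat) = ContinuousLinearMap.id ℂ TracelessMat :=
    (hasMFDerivAt_slToPSL A).mfderiv
  have h1 : ∀ (g : BilinField TracelessMat PSL2C) (L : TracelessMat →L[ℂ] TracelessMat),
      L = ContinuousLinearMap.id ℂ TracelessMat →
      LinearMap.compl₁₂ (g (slToPSL A)) L.toLinearMap L.toLinearMap u v = g (slToPSL A) u v := by
    rintro g _ rfl
    rfl
  have h2 : slMetric A u v = pslMetric (slToPSL A) u v := h1 pslMetric _ h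
  rw [h2, isLeftInvariantMetric_pslMetric, leftTriv_slToPSL]

theorem PSL2C.halfTrace_lieBilin (u v w : TracelessMat) :
    halfTrace (lieBilin ℂ TracelessMat PSL2C u v) w =
      -halfTrace v (lieBilin ℂ TracelessMat PSL2C u w) := by
  rw [PSL2C.lieBilin_eq, PSL2C.lieBilin_eq]
  exact halfTrace_commutator u v w

theorem PSL2C.halfTrace_lieBilin_self (u v : TracelessMat) :
    halfTrace (lieBilin ℂ TracelessMat PSL2C u v) (lieBilin ℂ TracelessMat PSL2C u v) =
      -4 * (halfTrace u u * halfTrace v v) + 4 * halfTrace u v ^ 2 := by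
  rw [PSL2C.lieBilin_eq]
  exact halfTrace_commutator_self u v

theorem SL2C.lieBilin_eq_psl (u v : TracelessMat) :
    lieBilin ℂ TracelessMat SL2C u v = lieBilin ℂ TracelessMat PSL2C u v := by
  rw [SL2C.lieBilin_eq, PSL2C.lieBilin_eq]

end

theorem mainTheorem1 :
    IsHolomorphicRiemannianMetric pslMetric ∧
    IsHolomorphicRiemannianMetric slMetric ∧
    (∃ D : RealConnection TracelessMat PSL2C, IsLeviCivita pslMetric D) ∧
    (∀ D : RealConnection TracelessMat PSL2C, IsLeviCivita pslMetric D →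
      (∀ X Y : RealField TracelessMat PSL2C, IsLeftInvariant X → IsLeftInvariant Y →
        ∀ A : PSL2C, D.along X Y A =
          (1 / 2 : ℝ) • VectorField.mlieBracket 𝓘(ℝ, TracelessMat) X Y A) ∧
      (∀ V₁ V₂ V₃ : PSL2C.lieAlgebra,
        curvatureTensor D 1 V₁ V₂ V₃ = -((1 / 4 : ℂ) • ⁅⁅V₁, V₂⁆, V₃⁆))) ∧
    (∀ V₁ V₂ : PSL2C.lieAlgebra,
      pslMetric 1 ⁅V₁, V₂⁆ ⁅V₁, V₂⁆ =
        -4 * (pslMetric 1 V₁ V₁ * pslMetric 1 V₂ V₂) + 4 * pslMetric 1 V₁ V₂ ^ 2) ∧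
    HasConstantSectionalCurvature pslMetric (-1) ∧
    HasConstantSectionalCurvature slMetric (-1) := by
  have hp := isLeftInvariantMetric_pslMetric
  have hs := isLeftInvariantMetric_slMetric
  have hb := TracelessMat.halfTrace_symm
  have hn := TracelessMat.halfTrace_nondegenerate
  have hB := PSL2C.halfTrace_lieBilin
  have hB' : ∀ u v w, TracelessMat.halfTrace (lieBilin ℂ TracelessMat SL2C u v) w =
      -TracelessMat.halfTrace v (lieBilin ℂ TracelessMat SL2C u w) := by
    simpa only [SL2C.lieBilin_eq_psl] using hB
  have hG' : ∀ u v, TracelessMat.halfTrace (lieBilin ℂ TracelessMat SL2C u v)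
      (lieBilin ℂ TracelessMat SL2C u v) =
      -4 * (TracelessMat.halfTrace u u * TracelessMat.halfTrace v v) +
        4 * TracelessMat.halfTrace u v ^ 2 := by
    simpa only [SL2C.lieBilin_eq_psl] using PSL2C.halfTrace_lieBilin_self
  refine ⟨hp.isHolomorphicRiemannianMetric hb hn,
    hs.isHolomorphicRiemannianMetric hb hn,
    ⟨_, hp.isLeviCivita hB⟩, fun D hD => ⟨fun X Y hX hY A => ?_, fun u v w => ?_⟩,
    fun u v => ?_,
    hp.hasConstantSectionalCurvature hb hn hB
      PSL2C.halfTrace_lieBilin_self,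
    hs.hasConstantSectionalCurvature hb hn hB' hG'⟩
  · exact hp.along_of_isLeftInvariant hb hn hB hD hX hY A
  · have h := hp.leftTriv_curvatureTensor hb hn hB hD 1 u v w
    have e : ∀ z : TracelessMat, leftTriv ℝ TracelessMat (1 : PSL2C) z = z := leftTriv_one
    -- Stated on the model space, of which the real tangent space, the complex tangent space and the
    -- Lie algebra are all copies. At `1` the trivialization is the identity, and the real bracket
    -- and scalar become complex.
    have e1 : ∀ R u v w : TracelessMat, leftTriv ℝ TracelessMat (1 : PSL2C) R =
        -((1 / 4 : ℝ) • lieBilin ℝ TracelessMat PSL2C (lieBilin ℝ TracelessMat PSL2C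
          (leftTriv ℝ TracelessMat (1 : PSL2C) u) (leftTriv ℝ TracelessMat (1 : PSL2C) v))
          (leftTriv ℝ TracelessMat (1 : PSL2C) w)) →
        R = -((1 / 4 : ℂ) • lieBilin ℂ TracelessMat PSL2C
          (lieBilin ℂ TracelessMat PSL2C u v) w) := by
      intro R u v w h
      simp only [e, lieBilin_real_eq_complex] at h
      rw [h, ← Complex.coe_smul]
      norm_num
    exact e1 _ u v w h
  · have e : ∀ u v : TracelessMat, pslMetric 1 u v = TracelessMat.halfTrace u v := fun u v => by
      rw [hp, leftTriv_one, leftTriv_one]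
    have e1 : ∀ u v : TracelessMat, pslMetric 1 (lieBilin ℂ TracelessMat PSL2C u v)
        (lieBilin ℂ TracelessMat PSL2C u v) =
        -4 * (pslMetric 1 u u * pslMetric 1 v v) + 4 * pslMetric 1 u v ^ 2 := fun u v => by
      rw [e, e, e, e, PSL2C.halfTrace_lieBilin_self]
    exact e1 u v
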